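/- Let $(G,\mathcal B)$ be a measurable space, let $K$ be a transition kernel on $G$ that is reversible with respect to a probability measure $\pi$, i.e. $\int_A K(x,B)\,\pi(dx)=\int_B K(x,A)\,\pi(dx)$ for all $A,B\in\mathcal B$, and let $(X_i)_{i\ge 1}$ be a Markov chain with transition kernel $K$ and initial distribution $X_1\sim\nu$. Write $L_p=L_p(\pi)$ (real-valued functions) with norm $\|\cdot\|_p$, $Pf(x)=\int_G f(y)\,K(x,dy)$, $S(f)=\int_G f\,d\pi$ (also regarded as an operator with values in the constant functions), and for $n\ge 1$, $n_0\ge 0$ put $$S_{n,n_0}(f)=\frac1n\sum_{j=1}^n f(X_{j+n_0}),\qquad e_\nu(S_{n,n_0},f)=\bigl(\mathbb E\,|S_{n,n_0}(f)-S(f)|^2\bigr)^{1/2}.$$ Let $\Lambda=\sup\{\alpha:\alpha\in\operatorname{spec}(P-S)\}$, where $\operatorname{spec}(P-S)$ is the spectrum of $P-S\colon L_2\to L_2$, and assume $\Lambda<1$. Let $\operatorname{gap}(P)=1-\|P-S\|_{L_2\to L_2}$. Then $$\sup_{\|f\|_p\le 1} e_\nu(S_{n,n_0},f)^2\le \frac{2}{n(1-\Lambda)}+\frac{2\,C_\nu\,\gamma^{n_0}}{n^2(1-\gamma)^2}$$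 (the supremum being over measurable $f\colon G\to\mathbb R$, and $0^0=1$) holds in each of the following two cases. 1. $p=2$; $\nu\ll\pi$ with $\frac{d\nu}{d\pi}\in L_\infty$; $\gamma\in[0,1)$ and $M\in(0,\infty)$ are such that $K$ is $L_1$-exponentially convergent with $(\gamma,M)$, i.e. $\|P^m-S\|_{L_1\to L_1}\le \gamma^m M$ for all integers $m\ge 1$; $C_\nu=M\,\bigl\|\frac{d\nu}{d\pi}-1\bigr\|_\infty$; and, if $n_0=0$, moreover $M\ge 1$. 2. $p=4$; $\nu\ll\pi$ with $\frac{d\nu}{d\pi}\in L_2$; $1-\gamma=\operatorname{gap}(P)>0$; $C_\nu=64\,\bigl\|\frac{d\nu}{d\pi}-1\bigr\|_2$. -/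

import Mathlib

open MeasureTheory ProbabilityTheory
open scoped ENNReal

namespace MCMC

section Operators

variable {G : Type*} [MeasurableSpace G]

/-- For a Markov kernel `K` with stationary distribution `π`, averaging against `K` does not
increase `L_p(π)`-seminorms. -/
theorem eLpNorm_average_le {K : Kernel G G} [IsMarkovKernel K] {π : Measure G}
    (hK : K.Invariant π) {p : ℝ≥0∞} (hp : 1 ≤ p) {f : G → ℝ} (hf : MemLp f p π) :
    eLpNorm (fun x => ∫ y, f y ∂(K x)) p π ≤ eLpNorm f p π := by
  have hbind : K ∘ₘ π = π := hK
  have hfm : AEStronglyMeasurable f (K ∘ₘ π) := by rw [hbind]; exact hf.1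
  have hmeas : ∀ᵐ x ∂π, AEStronglyMeasurable f (K x) := by
    filter_upwards [Measure.ae_ae_of_ae_comp hfm.ae_eq_mk] with x hx
    exact ⟨_, hfm.stronglyMeasurable_mk, hx⟩
  have hpt : ∀ᵐ x ∂π, ‖∫ y, f y ∂(K x)‖ₑ ≤ eLpNorm f p (K x) := by
    filter_upwards [hmeas] with x hx
    calc ‖∫ y, f y ∂(K x)‖ₑ ≤ ∫⁻ y, ‖f y‖ₑ ∂(K x) := enorm_integral_le_lintegral_enorm _
      _ = eLpNorm f 1 (K x) := eLpNorm_one_eq_lintegral_enorm.symm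
      _ ≤ eLpNorm f p (K x) := eLpNorm_le_eLpNorm_of_exponent_le hp hx
  rcases eq_or_ne p ∞ with rfl | htop
  · rw [eLpNorm_exponent_top (f := fun x => ∫ y, f y ∂(K x))]
    refine essSup_le_of_ae_le _ ?_
    have h1 : ∀ᵐ y ∂(K ∘ₘ π), ‖f y‖ₑ ≤ eLpNorm f ∞ π := by
      rw [hbind, eLpNorm_exponent_top]
      exact ae_le_eLpNormEssSup
    filter_upwards [hpt, Measure.ae_ae_of_ae_comp h1] with x hx hx1
    refine hx.trans ?_
    rw [eLpNorm_exponent_top (μ := K x)]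
    exact essSup_le_of_ae_le _ hx1
  · have h0 : p ≠ 0 := (zero_lt_one.trans_le hp).ne'
    have hpos : 0 < p.toReal := ENNReal.toReal_pos h0 htop
    rw [eLpNorm_eq_lintegral_rpow_enorm_toReal h0 htop,
      eLpNorm_eq_lintegral_rpow_enorm_toReal h0 htop]
    refine ENNReal.rpow_le_rpow ?_ (by positivity)
    calc ∫⁻ x, ‖∫ y, f y ∂(K x)‖ₑ ^ p.toReal ∂π
        ≤ ∫⁻ x, ∫⁻ y, ‖f y‖ₑ ^ p.toReal ∂(K x) ∂π := by
          refine lintegral_mono_ae ?_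
          filter_upwards [hpt] with x hx
          refine (ENNReal.rpow_le_rpow hx hpos.le).trans ?_
          rw [eLpNorm_eq_lintegral_rpow_enorm_toReal h0 htop, ← ENNReal.rpow_mul,
            one_div_mul_cancel hpos.ne', ENNReal.rpow_one]
      _ = ∫⁻ y, ‖f y‖ₑ ^ p.toReal ∂(K ∘ₘ π) := by
          rw [Measure.lintegral_bind K.aemeasurable]
          exact hfm.enorm.pow_const _
      _ = ∫⁻ y, ‖f y‖ₑ ^ p.toReal ∂π := by rw [hbind]

theorem memLp_average {K : Kernel G G} [IsMarkovKernel K] {π : Measure G}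
    (hK : K.Invariant π) {p : ℝ≥0∞} (hp : 1 ≤ p) {f : G → ℝ} (hf : MemLp f p π) :
    MemLp (fun x => ∫ y, f y ∂(K x)) p π := by
  have hbind : K ∘ₘ π = π := hK
  have hfm : AEStronglyMeasurable f (K ∘ₘ π) := by rw [hbind]; exact hf.1
  refine ⟨⟨fun x => ∫ y, hfm.mk f y ∂(K x), hfm.stronglyMeasurable_mk.integral_kernel, ?_⟩,
    (eLpNorm_average_le hK hp hf).trans_lt hf.2⟩
  filter_upwards [Measure.ae_ae_of_ae_comp hfm.ae_eq_mk] with x hx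
  exact integral_congr_ae hx

theorem average_congr {K : Kernel G G} {π : Measure G} (hK : K.Invariant π) {f g : G → ℝ}
    (hfg : f =ᵐ[π] g) :
    (fun x => ∫ y, f y ∂(K x)) =ᵐ[π] fun x => ∫ y, g y ∂(K x) := by
  have hbind : K ∘ₘ π = π := hK
  have h : f =ᵐ[K ∘ₘ π] g := by rw [hbind]; exact hfg
  filter_upwards [Measure.ae_ae_of_ae_comp h] with x hx
  exact integral_congr_ae hx

theorem ae_integrable {K : Kernel G G} [IsMarkovKernel K] {π : Measure G}
    [IsProbabilityMeasure π] (hK : K.Invariant π) {p : ℝ≥0∞} (hp : 1 ≤ p) {f : G → ℝ}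
    (hf : MemLp f p π) : ∀ᵐ x ∂π, Integrable f (K x) := by
  have hbind : K ∘ₘ π = π := hK
  have h : Integrable f (K ∘ₘ π) := by rw [hbind]; exact hf.integrable hp
  exact Measure.ae_integrable_of_integrable_comp h

/-- The Markov operator `P f (x) = ∫ f(y) K(x, dy)` as a bounded linear operator on the real
space `L_p(π)`, for a transition kernel `K` with stationary distribution `π`. -/
noncomputable def markovOp (K : Kernel G G) [IsMarkovKernel K] {π : Measure G}
    [IsProbabilityMeasure π] (hK : K.Invariant π) (p : ℝ≥0∞) [hp : Fact (1 ≤ p)] :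
    Lp ℝ p π →L[ℝ] Lp ℝ p π :=
  LinearMap.mkContinuous
    { toFun := fun f => (memLp_average hK hp.out (Lp.memLp f)).toLp
        (fun x => ∫ y, f y ∂(K x))
      map_add' := by
        intro f g
        rw [← MemLp.toLp_add]
        refine MemLp.toLp_congr _ _ ((average_congr hK (Lp.coeFn_add f g)).trans ?_)
        filter_upwards [ae_integrable hK hp.out (Lp.memLp f),
          ae_integrable hK hp.out (Lp.memLp g)] with x hf hg
        exact integral_add hf hg
      map_smul' := by
        intro c f
        simp only [RingHom.id_apply]
        rw [← MemLp.toLp_const_smul]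
        refine MemLp.toLp_congr _ _ ((average_congr hK (Lp.coeFn_smul c f)).trans ?_)
        filter_upwards with x
        exact integral_const_mul c _ }
    1
    (by
      intro f
      simp only [LinearMap.coe_mk, AddHom.coe_mk, one_mul]
      rw [Lp.norm_toLp, Lp.norm_def]
      exact ENNReal.toReal_mono (Lp.memLp f).2.ne
        (eLpNorm_average_le hK hp.out (Lp.memLp f)))

theorem markovOp_ae (K : Kernel G G) [IsMarkovKernel K] {π : Measure G}
    [IsProbabilityMeasure π] (hK : K.Invariant π) (p : ℝ≥0∞) [hp : Fact (1 ≤ p)]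
    (f : Lp ℝ p π) : markovOp K hK p f =ᵐ[π] fun x => ∫ y, f y ∂(K x) :=
  MemLp.coeFn_toLp (memLp_average hK hp.out (Lp.memLp f))

theorem invariant_const (π : Measure G) [IsProbabilityMeasure π] :
    (Kernel.const G π).Invariant π := by
  simp [Kernel.Invariant]

/-- The operator `S f = ∫ f dπ` on `L_p(π)`, with values in the constant functions; it is the
Markov operator of the kernel `K(x, ·) = π`. -/
noncomputable def meanOp (π : Measure G) [IsProbabilityMeasure π] (p : ℝ≥0∞)
    [Fact (1 ≤ p)] : Lp ℝ p π →L[ℝ] Lp ℝ p π :=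
  markovOp (Kernel.const G π) (invariant_const π) p

theorem meanOp_ae (π : Measure G) [IsProbabilityMeasure π] (p : ℝ≥0∞) [Fact (1 ≤ p)]
    (f : Lp ℝ p π) : meanOp π p f =ᵐ[π] fun _ => ∫ y, f y ∂π := by
  exact markovOp_ae (Kernel.const G π) (invariant_const π) p f

/-- `Λ = sup spec(P - S)`, with `P - S` acting on `L_2(π)`. -/
noncomputable def spectralTop (K : Kernel G G) [IsMarkovKernel K] {π : Measure G}
    [IsProbabilityMeasure π] (hK : K.Invariant π) : ℝ :=
  sSup (spectrum ℝ (markovOp K hK 2 - meanOp π 2))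

/-- `gap(P) = 1 - ‖P - S‖_{L_2 → L_2}`. -/
noncomputable def gap (K : Kernel G G) [IsMarkovKernel K] {π : Measure G}
    [IsProbabilityMeasure π] (hK : K.Invariant π) : ℝ :=
  1 - ‖markovOp K hK 2 - meanOp π 2‖

/-- `L_1`-exponential convergence with `(α, M)`: `‖P^n - S‖_{L_1 → L_1} ≤ α^n M` for all
`n ≥ 1`, where `α ∈ [0,1)` and `M ∈ (0,∞)`. -/
def IsL1ExpConvergent (K : Kernel G G) [IsMarkovKernel K] {π : Measure G}
    [IsProbabilityMeasure π] (hK : K.Invariant π) (α M : ℝ) : Prop :=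
  0 ≤ α ∧ α < 1 ∧ 0 < M ∧
    ∀ n : ℕ, 1 ≤ n → ‖markovOp K hK 1 ^ n - meanOp π 1‖ ≤ α ^ n * M

/-- The density `dν/dπ` as a real function. -/
noncomputable def density (ν π : Measure G) : G → ℝ := fun x => (ν.rnDeriv π x).toReal

end Operators

section Chains

variable {G Ω : Type*} [MeasurableSpace G] [MeasurableSpace Ω]

/-- `X 1, X 2, …` is a Markov chain with transition kernel `K` and initial distribution `ν`
on `(Ω, μ)`: `X 1` has law `ν`, and the conditional probability of `X (i + 1) ∈ A` given
`X 1, …, X i` is `K (X i, A)`. The variable `X 0` plays no role. -/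
structure IsMarkovChain (K : Kernel G G) (ν : Measure G) (X : ℕ → Ω → G) (μ : Measure Ω) :
    Prop where
  measurable : ∀ i, 1 ≤ i → Measurable (X i)
  initial : μ.map (X 1) = ν
  transition : ∀ i, 1 ≤ i → ∀ A : Set G, MeasurableSet A →
    μ[(X (i + 1) ⁻¹' A).indicator (fun _ => (1 : ℝ)) |
        ⨆ j ∈ Set.Icc 1 i, MeasurableSpace.comap (X j) inferInstance]
      =ᵐ[μ] fun ω => (K (X i ω)).real A

/-- `S_{n,n₀}(f) = (1/n) ∑_{j=1}^n f(X_{j+n₀})`. -/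
noncomputable def mcmcAverage (X : ℕ → Ω → G) (n n₀ : ℕ) (f : G → ℝ) (ω : Ω) : ℝ :=
  (1 / n : ℝ) * ∑ j ∈ Finset.Icc 1 n, f (X (j + n₀) ω)

/-- The root mean square error `e(S_{n,n₀}, f) = (𝔼 |S_{n,n₀}(f) - ∫ f dπ|²)^{1/2} ∈ [0,∞]`. -/
noncomputable def mcmcError (μ : Measure Ω) (π : Measure G) (X : ℕ → Ω → G) (n n₀ : ℕ)
    (f : G → ℝ) : ℝ≥0∞ :=
  (∫⁻ ω, ENNReal.ofReal (|mcmcAverage X n n₀ f ω - ∫ x, f x ∂π| ^ 2) ∂μ) ^ (1 / 2 : ℝ)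

/-- `sup { e(S_{n,n₀}, f)² : f measurable, ‖f‖_{L_p(π)} ≤ 1 }`. -/
noncomputable def worstCaseSqError (μ : Measure Ω) (π : Measure G) (X : ℕ → Ω → G)
    (n n₀ : ℕ) (p : ℝ≥0∞) : ℝ≥0∞ :=
  ⨆ (f : G → ℝ) (_ : Measurable f) (_ : eLpNorm f p π ≤ 1), mcmcError μ π X n n₀ f ^ 2

end Chains

end MCMC

/-!
The error of the Markov chain average is compared with its value for the stationary chain, with
`g = f - S f` and `A = P - S` on `L₂(π)`. Expanding the square reduces the mean square error to the
correlations of `g(X_{m+1})` and `g(X_{m+l+1})`, which are `∫ g Pˡg d(Kᵐ ∘ ν)`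
(`IsMarkovChain.integral_mul`).

Replacing `Kᵐ ∘ ν` by `π` leaves the stationary correlations `⟪Aˡ g, g⟫`. Reversibility makes `A`
symmetric, and the numerical inequality `1 + 2 ∑_{l ≤ N} λˡ ≤ 2 / (1 - λ)` for `λ ∈ [-1, 1)`
becomes `‖g‖² + 2 ∑ ⟪Aˡ g, g⟫ ≤ 2 / (1 - Λ) ‖g‖²`. Instead of a functional calculus on the real
space `L₂(π)`, the proof uses that `Λ` bounds the quadratic form of `A`
(`inner_map_self_le_sSup_spectrum`), solves `y - A y = g`, telescopes the sum, and checks the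
remaining positivity by hand (`norm_sq_add_two_mul_sum_inner_pow_le`).

The difference between `Kᵐ ∘ ν` and `π`, tested on `h = g Pˡ g`, is
`∫ (dν/dπ - 1) (Pᵐ - S) h dπ`. Hölder's inequality bounds it by the norm of `dν/dπ - 1`, the
norm of `Pᵐ - S` on `L_q` with `q = 1` or `q = 2`, and `‖g Pˡ g‖_q` (`integral_pow_comp_le`); a
double geometric series over `m` and `l` gives the second term, provided `‖g Pˡ g‖_q` decays
geometrically.

* For `q = 1` this needs `‖P - S‖ ≤ γ` on `L₂`. For bounded `f` the correlations `⟪Aⁿ f, f⟫` decay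
  at the rate `γ` of the `L₁` norms, and log-convexity of `n ↦ ‖Aⁿ f‖` turns this into
  `‖A f‖ ≤ γ ‖f‖` (`norm_markovOp_sub_meanOp_le_of_isL1ExpConvergent`).
* For `q = 2` it needs decay of `Pˡ g` in `L₄`. Marcinkiewicz interpolation between the `L₂` norm
  `γˡ` and the `L_∞` norm `2` gives `‖(Pˡ - S) f‖₄ ≤ 4 γ^{l/2} ‖f‖₄`
  (`eLpNorm_four_average_sub_mean_le`), which is summable with room to spare in the constant `64`.
-/

namespace MCMC

/-! ### Symmetric operators on real Hilbert spaces -/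

section Hilbert

open scoped InnerProductSpace

variable {H : Type*} [NormedAddCommGroup H] [InnerProductSpace ℝ H]

/-- Cauchy–Schwarz for the positive semidefinite form `⟪B x, y⟫`. -/
theorem norm_sq_le_of_nonneg {B : H →L[ℝ] H} (hB : (B : H →ₗ[ℝ] H).IsSymmetric)
    (hpos : ∀ x, 0 ≤ ⟪B x, x⟫_ℝ) (x : H) : ‖B x‖ ^ 2 ≤ ‖B‖ * ⟪B x, x⟫_ℝ := by
  rcases (norm_nonneg B).eq_or_lt with h0 | h0
  · have : B = 0 := norm_eq_zero.mp h0.symm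
    simp [this]
  -- the form is nonnegative at `‖B‖ x - B x`
  have h := hpos (‖B‖ • x - B x)
  have e1 : ⟪B (B x), x⟫_ℝ = ‖B x‖ ^ 2 := by
    rw [← real_inner_self_eq_norm_sq]; exact hB (B x) x
  have e2 : ⟪B (B x), B x⟫_ℝ ≤ ‖B‖ * ‖B x‖ ^ 2 := by
    refine (real_inner_le_norm _ _).trans ?_
    nlinarith [B.le_opNorm (B x), norm_nonneg (B x)]
  simp only [map_sub, map_smul, inner_sub_left, inner_sub_right, real_inner_smul_left,
    real_inner_smul_right, e1, real_inner_self_eq_norm_sq] at h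
  have : ‖B‖ * ‖B x‖ ^ 2 ≤ ‖B‖ * (‖B‖ * ⟪B x, x⟫_ℝ) := by nlinarith
  exact le_of_mul_le_mul_left this h0

/-- The top of the spectrum bounds the quadratic form of a symmetric operator, because the supremum
of the Rayleigh quotient belongs to the spectrum. -/
theorem inner_map_self_le_sSup_spectrum [CompleteSpace H] {A : H →L[ℝ] H}
    (hA : (A : H →ₗ[ℝ] H).IsSymmetric) (x : H) :
    ⟪A x, x⟫_ℝ ≤ sSup (spectrum ℝ A) * ‖x‖ ^ 2 := by
  rcases eq_or_ne x 0 with rfl | hx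
  · simp
  set S : Set ℝ := {r | ∃ y : H, ‖y‖ = 1 ∧ r = ⟪A y, y⟫_ℝ} with hS
  have hbdd : BddAbove S := by
    refine ⟨‖A‖, ?_⟩
    rintro r ⟨y, hy, rfl⟩
    refine (real_inner_le_norm _ _).trans ?_
    simpa [hy] using A.le_opNorm y
  have hray : ∀ y : H, ⟪A y, y⟫_ℝ ≤ sSup S * ‖y‖ ^ 2 := by
    intro y
    rcases eq_or_ne y 0 with rfl | hy
    · simp
    have hy' : ‖y‖ ≠ 0 := norm_ne_zero_iff.mpr hy
    have h1 : ⟪A (‖y‖⁻¹ • y), ‖y‖⁻¹ • y⟫_ℝ ≤ sSup S :=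
      le_csSup hbdd ⟨‖y‖⁻¹ • y, by rw [norm_smul, norm_inv, norm_norm, inv_mul_cancel₀ hy'], rfl⟩
    rw [map_smul, real_inner_smul_left, real_inner_smul_right, ← mul_assoc, ← mul_inv, ← sq,
      inv_mul_le_iff₀ (by positivity)] at h1
    linarith
  have hne : S.Nonempty := by
    have hx' : ‖x‖ ≠ 0 := norm_ne_zero_iff.mpr hx
    exact ⟨_, ‖x‖⁻¹ • x, by rw [norm_smul, norm_inv, norm_norm, inv_mul_cancel₀ hx'], rfl⟩
  have hmem : sSup S ∈ spectrum ℝ A := by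
    rw [spectrum.mem_iff]
    intro hu
    set B : H →L[ℝ] H := algebraMap ℝ (H →L[ℝ] H) (sSup S) - A with hBdef
    have hBx : ∀ y, B y = sSup S • y - A y := fun y => by
      simp [hBdef, Algebra.algebraMap_eq_smul_one]
    have hBin : ∀ y, ⟪B y, y⟫_ℝ = sSup S * ‖y‖ ^ 2 - ⟪A y, y⟫_ℝ := fun y => by
      rw [hBx, inner_sub_left, real_inner_smul_left, real_inner_self_eq_norm_sq]
    have hBsym : (B : H →ₗ[ℝ] H).IsSymmetric := by
      intro y z
      have := hA y z
      simp only [ContinuousLinearMap.coe_coe] at this ⊢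
      rw [hBx, hBx, inner_sub_left, inner_sub_right, real_inner_smul_left,
        real_inner_smul_right, this]
    have hBpos : ∀ y, 0 ≤ ⟪B y, y⟫_ℝ := fun y => by rw [hBin]; linarith [hray y]
    obtain ⟨C, hC⟩ : ∃ C : H →L[ℝ] H, ∀ y, C (B y) = y := by
      obtain ⟨u, hu⟩ := hu
      refine ⟨((u⁻¹ : (H →L[ℝ] H)ˣ) : H →L[ℝ] H), fun y => ?_⟩
      have h2 : ((u⁻¹ : (H →L[ℝ] H)ˣ) : H →L[ℝ] H) * B = 1 := by rw [← hu]; simp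
      exact DFunLike.congr_fun h2 y
    -- invertibility makes the nonnegative form of `B` coercive
    have hcoer : ∀ y : H, ‖y‖ = 1 → 1 ≤ ‖C‖ ^ 2 * (‖B‖ * ⟪B y, y⟫_ℝ) := by
      intro y hy
      have h3 : 1 ≤ ‖C‖ * ‖B y‖ := by
        have := C.le_opNorm (B y)
        rwa [hC, hy] at this
      calc (1 : ℝ) ≤ (‖C‖ * ‖B y‖) ^ 2 := one_le_pow₀ h3
        _ = ‖C‖ ^ 2 * ‖B y‖ ^ 2 := by ring
        _ ≤ _ := by gcongr; exact norm_sq_le_of_nonneg hBsym hBpos y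
    set D := ‖C‖ ^ 2 * ‖B‖ with hD
    have hDpos : 0 < D := by
      obtain ⟨r, y, hy, -⟩ := hne
      have h4 := hcoer y hy
      rw [← mul_assoc] at h4
      by_contra hcon
      nlinarith [hBpos y]
    have hlt : sSup S - D⁻¹ < sSup S := by simpa using hDpos
    obtain ⟨r, ⟨y, hy, rfl⟩, hr⟩ := exists_lt_of_lt_csSup hne hlt
    have h5 := hcoer y hy
    rw [← mul_assoc, ← hD, hBin, hy] at h5
    have h6 : D * (sSup S * 1 ^ 2 - ⟪A y, y⟫_ℝ) < D * D⁻¹ := by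
      gcongr; linarith
    rw [mul_inv_cancel₀ hDpos.ne'] at h6
    linarith
  exact (hray x).trans (mul_le_mul_of_nonneg_right
    (le_csSup (spectrum.isCompact A).bddAbove hmem) (sq_nonneg _))

theorem isSymmetric_pow {A : H →L[ℝ] H} (hA : (A : H →ₗ[ℝ] H).IsSymmetric) (n : ℕ) (x y : H) :
    ⟪(A ^ n) x, y⟫_ℝ = ⟪x, (A ^ n) y⟫_ℝ := by
  induction n generalizing x y with
  | zero => simp
  | succ n ih =>
    rw [pow_succ, mul_apply_eq_comp, ih, ← pow_succ, pow_succ',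
      mul_apply_eq_comp]
    exact hA _ _

theorem norm_pow_apply_le {A : H →L[ℝ] H} (hA1 : ‖A‖ ≤ 1) (n : ℕ) (x : H) :
    ‖(A ^ n) x‖ ≤ ‖x‖ := by
  induction n with
  | zero => simp
  | succ n ih =>
    rw [pow_succ', mul_apply_eq_comp]
    refine (A.le_of_opNorm_le hA1 _).trans ?_
    rwa [one_mul]

/-- For `λ ∈ [-1, 1)` the number `(1 - λ) ^ 2 + 2 λ ^ k (1 - λ)` is nonnegative; this is the
corresponding statement for a symmetric contraction, with `x = (1 - A) y`. -/
theorem norm_sq_add_two_mul_inner_pow_nonneg {A : H →L[ℝ] H} (hA : (A : H →ₗ[ℝ] H).IsSymmetric)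
    (hA1 : ‖A‖ ≤ 1) {x y : H} (hy : y - A y = x) (k : ℕ) :
    0 ≤ ‖x‖ ^ 2 + 2 * ⟪(A ^ k) y, x⟫_ℝ := by
  have hbound : ∀ v : H, ‖A v‖ ≤ ‖v‖ := fun v => by simpa using norm_pow_apply_le hA1 1 v
  have hcomm : ∀ i, (A ^ i) x = (A ^ i) y - A ((A ^ i) y) := fun i => by
    rw [← hy, map_sub, ← mul_apply_eq_comp, ← mul_apply_eq_comp,
      ← pow_succ, ← pow_succ']
  -- halving the exponent leaves forms in `v = A ^ i y` and `w = v - A v = A ^ i x`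
  rcases Nat.even_or_odd' k with ⟨i, rfl | rfl⟩
  · have h1 : ⟪(A ^ (2 * i)) y, x⟫_ℝ = ⟪(A ^ i) y, (A ^ i) x⟫_ℝ := by
      rw [two_mul, pow_add, mul_apply_eq_comp, isSymmetric_pow hA]
    rw [h1, hcomm, inner_sub_right, real_inner_self_eq_norm_sq]
    have h2 := real_inner_le_norm ((A ^ i) y) (A ((A ^ i) y))
    have h3 := hbound ((A ^ i) y)
    nlinarith [norm_nonneg ((A ^ i) y), sq_nonneg ‖x‖]
  · have h1 : ⟪(A ^ (2 * i + 1)) y, x⟫_ℝ = ⟪A ((A ^ i) y), (A ^ i) x⟫_ℝ := by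
      rw [two_mul, add_assoc, pow_add, mul_apply_eq_comp, isSymmetric_pow hA,
        pow_succ', mul_apply_eq_comp]
    have hw := norm_pow_apply_le hA1 i x
    have hv := hbound ((A ^ i) y)
    have hw2 : ‖(A ^ i) x‖ ^ 2 ≤ ‖x‖ ^ 2 := by gcongr
    have hv2 : ‖A ((A ^ i) y)‖ ^ 2 ≤ ‖(A ^ i) y‖ ^ 2 := by gcongr
    rw [h1, hcomm, inner_sub_right, real_inner_self_eq_norm_sq]
    rw [hcomm, norm_sub_sq_real] at hw2
    rw [real_inner_comm] at hw2
    nlinarith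

/-- The operator form of the inequality
`1 + 2 ∑_{i=1}^m λ ^ i = (1 + λ - 2 λ ^ (m + 1)) / (1 - λ) ≤ 2 / (1 - λ)` on the spectrum. -/
theorem norm_sq_add_two_mul_sum_inner_pow_le [CompleteSpace H] {A : H →L[ℝ] H}
    (hA : (A : H →ₗ[ℝ] H).IsSymmetric) (hA1 : ‖A‖ ≤ 1) (hΛ : sSup (spectrum ℝ A) < 1)
    (x : H) (m : ℕ) :
    ‖x‖ ^ 2 + 2 * ∑ i ∈ Finset.Icc 1 m, ⟪(A ^ i) x, x⟫_ℝ
      ≤ 2 / (1 - sSup (spectrum ℝ A)) * ‖x‖ ^ 2 := by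
  set c := 1 - sSup (spectrum ℝ A) with hc
  have hcpos : 0 < c := by linarith
  have hcoer : ∀ v : H, c * ‖v‖ ^ 2 ≤ ⟪v - A v, v⟫_ℝ := fun v => by
    rw [inner_sub_left, real_inner_self_eq_norm_sq, hc]
    linarith [inner_map_self_le_sSup_spectrum hA v]
  obtain ⟨y, hy⟩ : ∃ y, y - A y = x := by
    have hu : IsUnit (1 - A) := by
      refine ContinuousLinearMap.isUnit_of_forall_le_norm_inner_map _ (c := ⟨c, hcpos.le⟩)
        (by exact_mod_cast hcpos) fun v => ?_
      refine le_trans ?_ (le_abs_self _)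
      rw [mul_comm]
      exact hcoer v
    obtain ⟨y, hy⟩ := (ContinuousLinearMap.isUnit_iff_bijective.mp hu).2 x
    exact ⟨y, by simpa using hy⟩
  -- the sum telescopes
  have htel : ‖x‖ ^ 2 + ∑ i ∈ Finset.Icc 1 m, ⟪(A ^ i) x, x⟫_ℝ
      = ⟪y, x⟫_ℝ - ⟪(A ^ (m + 1)) y, x⟫_ℝ := by
    have hstep : ∀ i, (A ^ i) x = (A ^ i) y - (A ^ (i + 1)) y := fun i => by
      rw [← hy, map_sub, pow_succ A i, mul_apply_eq_comp]
    induction m with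
    | zero =>
      rw [← inner_sub_left]
      simp [hy]
    | succ m ih =>
      rw [Finset.sum_Icc_succ_top (by omega), ← add_assoc, ih, hstep (m + 1), inner_sub_left]
      ring
  have h1 := norm_sq_add_two_mul_inner_pow_nonneg hA hA1 hy (m + 1)
  have hyx : ⟪y, x⟫_ℝ ≤ c⁻¹ * ‖x‖ ^ 2 := by
    have h2 : c * ‖y‖ ^ 2 ≤ ⟪y, x⟫_ℝ := by
      have := hcoer y
      rwa [hy, real_inner_comm] at this
    have h3 := real_inner_le_norm y x
    have h4 : c * ‖y‖ ≤ ‖x‖ := by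
      rcases (norm_nonneg y).eq_or_lt with h0 | h0
      · rw [← h0]; simp
      · nlinarith
    have h5 : ‖y‖ ≤ c⁻¹ * ‖x‖ := by rwa [le_inv_mul_iff₀ hcpos]
    nlinarith [norm_nonneg x]
  calc _ = 2 * ⟪y, x⟫_ℝ - (‖x‖ ^ 2 + 2 * ⟪(A ^ (m + 1)) y, x⟫_ℝ) := by linarith
    _ ≤ 2 * (c⁻¹ * ‖x‖ ^ 2) := by linarith
    _ = _ := by rw [div_eq_mul_inv]; ring

/-- For a symmetric operator the sequence `‖A ^ n x‖` is logarithmically convex, so its geometric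
decay rate along the powers of two already bounds the first ratio `‖A x‖ / ‖x‖`. -/
theorem norm_apply_le_of_inner_pow_le {A : H →L[ℝ] H} (hA : (A : H →ₗ[ℝ] H).IsSymmetric)
    {γ C : ℝ} (hγ : 0 ≤ γ) {x : H}
    (h : ∀ n : ℕ, 1 ≤ n → ⟪(A ^ n) x, x⟫_ℝ ≤ C * γ ^ n) : ‖A x‖ ≤ γ * ‖x‖ := by
  rcases eq_or_ne x 0 with rfl | hx
  · simp
  have hx0 : 0 < ‖x‖ := norm_pos_iff.mpr hx
  -- otherwise the ratio `q = ‖A x‖ / ‖x‖ > γ` propagates to `‖A ^ (2 ^ k) x‖ ≥ q ^ (2 ^ k) ‖x‖`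
  by_contra! hcon
  set q := ‖A x‖ / ‖x‖ with hq
  have hγq : γ < q := by rwa [hq, lt_div_iff₀ hx0]
  have hq0 : 0 < q := hγ.trans_lt hγq
  have hsq : ∀ n, ‖(A ^ n) x‖ ^ 2 = ⟪(A ^ (n + n)) x, x⟫_ℝ := fun n => by
    rw [pow_add, mul_apply_eq_comp, isSymmetric_pow hA, real_inner_self_eq_norm_sq]
  have hlow : ∀ k : ℕ, q ^ (2 ^ k) * ‖x‖ ≤ ‖(A ^ (2 ^ k)) x‖ := by
    intro k
    induction k with
    | zero => simp [hq, hx0.ne']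
    | succ k ih =>
      have h1 : ‖(A ^ (2 ^ k)) x‖ ^ 2 ≤ ‖(A ^ (2 ^ (k + 1))) x‖ * ‖x‖ := by
        rw [hsq, ← two_mul, ← pow_succ']
        exact real_inner_le_norm _ _
      have h2 : (q ^ (2 ^ k) * ‖x‖) ^ 2 ≤ ‖(A ^ (2 ^ k)) x‖ ^ 2 := by gcongr
      have h3 : (q ^ (2 ^ (k + 1)) * ‖x‖) * ‖x‖ = (q ^ (2 ^ k) * ‖x‖) ^ 2 := by
        rw [pow_succ 2 k, pow_mul]; ring
      exact le_of_mul_le_mul_right (h3.trans_le (h2.trans h1)) hx0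
  have hup : ∀ k : ℕ, ‖x‖ ^ 2 ≤ C * (γ / q) ^ (2 ^ (k + 1)) := by
    intro k
    have h1 : (q ^ (2 ^ k) * ‖x‖) ^ 2 ≤ C * γ ^ (2 ^ (k + 1)) := by
      calc (q ^ (2 ^ k) * ‖x‖) ^ 2 ≤ ‖(A ^ (2 ^ k)) x‖ ^ 2 := by gcongr; exact hlow k
        _ = ⟪(A ^ (2 ^ (k + 1))) x, x⟫_ℝ := by rw [hsq, ← two_mul, ← pow_succ']
        _ ≤ _ := h _ Nat.one_le_two_pow
    rw [div_pow, mul_div_assoc', le_div_iff₀ (by positivity)]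
    calc ‖x‖ ^ 2 * q ^ 2 ^ (k + 1) = (q ^ (2 ^ k) * ‖x‖) ^ 2 := by
          rw [pow_succ 2 k, pow_mul]; ring
      _ ≤ _ := h1
  have hlim : Filter.Tendsto (fun k : ℕ => C * (γ / q) ^ (2 ^ (k + 1))) Filter.atTop
      (nhds (C * 0)) := by
    refine Filter.Tendsto.const_mul _ ?_
    refine (tendsto_pow_atTop_nhds_zero_of_lt_one (by positivity)
      ((div_lt_one hq0).mpr hγq)).comp ?_
    exact (tendsto_pow_atTop_atTop_of_one_lt (by norm_num)).comp (Filter.tendsto_add_atTop_nat 1)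
  have := ge_of_tendsto' hlim hup
  rw [mul_zero] at this
  nlinarith

theorem opNorm_le_of_inner_pow_le {A : H →L[ℝ] H} (hA : (A : H →ₗ[ℝ] H).IsSymmetric)
    {γ : ℝ} (hγ : 0 ≤ γ) {D : Set H} (hD : Dense D)
    (h : ∀ x ∈ D, ∃ C : ℝ, ∀ n : ℕ, 1 ≤ n → ⟪(A ^ n) x, x⟫_ℝ ≤ C * γ ^ n) : ‖A‖ ≤ γ := by
  refine ContinuousLinearMap.opNorm_le_bound _ hγ fun x => ?_
  refine hD.induction (P := fun x => ‖A x‖ ≤ γ * ‖x‖) (fun x hx => ?_)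
    (isClosed_le (by fun_prop) (by fun_prop)) x
  obtain ⟨C, hC⟩ := h x hx
  exact norm_apply_le_of_inner_pow_le hA hγ hC

end Hilbert

/-! ### Powers of Markov operators and reversibility -/

section MarkovOperators

variable {G : Type*} [MeasurableSpace G]

instance isMarkovKernel_pow (K : Kernel G G) [IsMarkovKernel K] (n : ℕ) :
    IsMarkovKernel (K ^ n) := by
  induction n with
  | zero => exact inferInstanceAs (IsMarkovKernel Kernel.id)
  | succ n ih =>
    rw [pow_succ]
    exact inferInstanceAs (IsMarkovKernel ((K ^ n) ∘ₖ K))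

variable {π : Measure G}

theorem invariant_pow {K : Kernel G G} (hK : K.Invariant π) (n : ℕ) :
    (K ^ n).Invariant π := by
  induction n with
  | zero => exact Measure.id_comp
  | succ n ih => rw [pow_succ]; exact ih.comp hK

theorem integral_comp_measure {α β : Type*} [MeasurableSpace α] [MeasurableSpace β]
    {μ : Measure α} {κ : Kernel α β} {f : β → ℝ} (hf : Integrable f (κ ∘ₘ μ)) :
    ∫ y, f y ∂(κ ∘ₘ μ) = ∫ x, ∫ y, f y ∂(κ x) ∂μ := by
  rw [Measure.comp_eq_comp_const_apply] at hf ⊢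
  rw [Kernel.integral_comp hf, Kernel.const_apply]

theorem isReversible_const (π : Measure G) : (Kernel.const G π).IsReversible π := by
  intro A B _ _
  simp [mul_comm]

variable [IsProbabilityMeasure π]

/-- Composition of kernels reverses the order of the operators, as `(κ ∘ₖ η) x` averages `κ`
against `η x`. -/
theorem markovOp_comp {κ η : Kernel G G} [IsMarkovKernel κ] [IsMarkovKernel η]
    (hκ : κ.Invariant π) (hη : η.Invariant π) (h : (κ ∘ₖ η).Invariant π) (p : ℝ≥0∞)
    [hp : Fact (1 ≤ p)] :
    markovOp (κ ∘ₖ η) h p = markovOp η hη p * markovOp κ hκ p := by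
  refine ContinuousLinearMap.ext fun f => Lp.ext ?_
  rw [mul_apply_eq_comp]
  refine (markovOp_ae _ h p f).trans (.trans ?_ (markovOp_ae η hη p _).symm)
  refine .trans ?_ (average_congr hη (markovOp_ae κ hκ p f)).symm
  filter_upwards [ae_integrable h hp.out (Lp.memLp f)] with x hx
  exact Kernel.integral_comp hx

theorem markovOp_congr {κ η : Kernel G G} [IsMarkovKernel κ] [IsMarkovKernel η]
    (hκ : κ.Invariant π) (hη : η.Invariant π) (h : κ = η) (p : ℝ≥0∞) [Fact (1 ≤ p)] :
    markovOp κ hκ p = markovOp η hη p := by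
  subst h; rfl

variable {K : Kernel G G} [IsMarkovKernel K]

theorem markovOp_pow (hK : K.Invariant π) (p : ℝ≥0∞) [hp : Fact (1 ≤ p)] (n : ℕ) :
    markovOp (K ^ n) (invariant_pow hK n) p = markovOp K hK p ^ n := by
  induction n with
  | zero =>
    refine ContinuousLinearMap.ext fun f => Lp.ext ?_
    refine (markovOp_ae _ (invariant_pow hK 0) p f).trans ?_
    have hsm := (Lp.stronglyMeasurable f)
    filter_upwards with x
    change ∫ y, f y ∂(Kernel.id x) = f x
    rw [Kernel.id_apply, integral_dirac' _ _ hsm]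
  | succ n ih =>
    rw [pow_succ' (markovOp K hK p), ← ih]
    exact (markovOp_congr (invariant_pow hK (n + 1)) ((invariant_pow hK n).comp hK)
      (pow_succ K n) p).trans (markovOp_comp _ _ _ p)

theorem markovOp_mul_meanOp (hK : K.Invariant π) (p : ℝ≥0∞) [Fact (1 ≤ p)] :
    markovOp K hK p * meanOp π p = meanOp π p := by
  have h : Kernel.const G π ∘ₖ K = Kernel.const G π := by
    ext x s hs
    simp
  rw [meanOp, ← markovOp_comp (invariant_const π) hK ((invariant_const π).comp hK)]
  exact markovOp_congr _ _ h p

theorem meanOp_mul_markovOp (hK : K.Invariant π) (p : ℝ≥0∞) [Fact (1 ≤ p)] :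
    meanOp π p * markovOp K hK p = meanOp π p := by
  rw [meanOp, ← markovOp_comp hK (invariant_const π) (hK.comp (invariant_const π))]
  exact markovOp_congr _ _ hK.comp_const p

theorem meanOp_mul_meanOp (π : Measure G) [IsProbabilityMeasure π] (p : ℝ≥0∞) [Fact (1 ≤ p)] :
    meanOp π p * meanOp π p = meanOp π p :=
  markovOp_mul_meanOp (invariant_const π) p

theorem markovOp_sub_meanOp_pow (hK : K.Invariant π) (p : ℝ≥0∞) [Fact (1 ≤ p)] {n : ℕ}
    (hn : 1 ≤ n) :
    (markovOp K hK p - meanOp π p) ^ n = markovOp K hK p ^ n - meanOp π p := by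
  induction n, hn using Nat.le_induction with
  | base => simp
  | succ n hn ih =>
    have h : markovOp K hK p ^ n * meanOp π p = meanOp π p := by
      rw [← markovOp_pow]; exact markovOp_mul_meanOp _ p
    rw [pow_succ, ih, sub_mul, mul_sub, mul_sub, ← pow_succ, h, meanOp_mul_markovOp,
      meanOp_mul_meanOp, sub_self, sub_zero]

theorem eLpNorm_average_sub_mean_le (hK : K.Invariant π) {p : ℝ≥0∞} [hp : Fact (1 ≤ p)]
    {f : G → ℝ} (hf : MemLp f p π) :
    eLpNorm (fun x => ∫ y, f y ∂(K x) - ∫ y, f y ∂π) p π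
      ≤ ENNReal.ofReal ‖markovOp K hK p - meanOp π p‖ * eLpNorm f p π := by
  set F : Lp ℝ p π := hf.toLp f
  have hF : F =ᵐ[π] f := hf.coeFn_toLp
  have h1 : (markovOp K hK p - meanOp π p) F =ᵐ[π]
      fun x => ∫ y, f y ∂(K x) - ∫ y, f y ∂π := by
    have h2 := Lp.coeFn_sub (markovOp K hK p F) (meanOp π p F)
    rw [sub_apply]
    filter_upwards [h2, markovOp_ae K hK p F, meanOp_ae π p F, average_congr hK hF]
      with x a b c d
    rw [a, Pi.sub_apply, b, c, d, integral_congr_ae hF]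
  have h3 := (markovOp K hK p - meanOp π p).le_opNorm F
  rw [← eLpNorm_congr_ae h1, ← eLpNorm_congr_ae hF, ← Lp.enorm_def, ← Lp.enorm_def,
    ← ofReal_norm, ← ofReal_norm, ← ENNReal.ofReal_mul (norm_nonneg _)]
  exact ENNReal.ofReal_le_ofReal h3

/-- A reversible kernel makes the law of two consecutive states exchangeable. -/
theorem map_swap_compProd (hrev : K.IsReversible π) :
    (π ⊗ₘ K).map Prod.swap = π ⊗ₘ K := by
  have : IsFiniteMeasure ((π ⊗ₘ K).map Prod.swap) := inferInstance
  refine Measure.ext_prod fun {s t} hs ht => ?_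
  rw [Measure.map_apply measurable_swap (hs.prod ht), Set.preimage_swap_prod,
    Measure.compProd_apply_prod ht hs, Measure.compProd_apply_prod hs ht]
  exact hrev ht hs

theorem integral_mul_average (hK : K.Invariant π) {f g : G → ℝ} (hf : MemLp f 2 π)
    (hg : MemLp g 2 π) :
    ∫ x, g x * ∫ y, f y ∂(K x) ∂π = ∫ z, g z.1 * f z.2 ∂(π ⊗ₘ K) := by
  have h1 : MemLp (fun z : G × G => g z.1) 2 (π ⊗ₘ K) := by
    refine MemLp.comp_measurePreserving hg ⟨measurable_fst, ?_⟩
    exact Measure.fst_compProd π K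
  have h2 : MemLp (fun z : G × G => f z.2) 2 (π ⊗ₘ K) := by
    refine MemLp.comp_measurePreserving hf ⟨measurable_snd, ?_⟩
    exact (Measure.snd_compProd π K).trans hK
  have h3 : Integrable (fun z : G × G => g z.1 * f z.2) (π ⊗ₘ K) := h1.integrable_mul h2
  rw [Measure.integral_compProd h3]
  simp only [integral_const_mul]

theorem isSymmetric_markovOp (hrev : K.IsReversible π) :
    (markovOp K hrev.invariant 2 : Lp ℝ 2 π →ₗ[ℝ] Lp ℝ 2 π).IsSymmetric := by
  intro f g
  have h1 : inner ℝ (markovOp K hrev.invariant 2 f) g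
      = ∫ x, g x * ∫ y, f y ∂(K x) ∂π := by
    rw [L2.inner_def]
    refine integral_congr_ae ?_
    filter_upwards [markovOp_ae K hrev.invariant 2 f] with x hx
    rw [hx]; simp
  have h2 : inner ℝ f (markovOp K hrev.invariant 2 g)
      = ∫ x, f x * ∫ y, g y ∂(K x) ∂π := by
    rw [L2.inner_def]
    refine integral_congr_ae ?_
    filter_upwards [markovOp_ae K hrev.invariant 2 g] with x hx
    rw [hx]; simp [mul_comm]
  simp only [ContinuousLinearMap.coe_coe]
  rw [h1, h2, integral_mul_average hrev.invariant (Lp.memLp f) (Lp.memLp g),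
    integral_mul_average hrev.invariant (Lp.memLp g) (Lp.memLp f)]
  conv_lhs => rw [← map_swap_compProd hrev]
  have h3 := (MeasurableEquiv.prodComm (α := G) (β := G)).measurableEmbedding.integral_map
    (μ := π ⊗ₘ K) fun z : G × G => g z.1 * f z.2
  exact h3.trans (integral_congr_ae (.of_forall fun z => mul_comm _ _))

theorem isSymmetric_markovOp_sub_meanOp (hrev : K.IsReversible π) :
    (markovOp K hrev.invariant 2 - meanOp π 2 : Lp ℝ 2 π →L[ℝ] Lp ℝ 2 π).toLinearMap.IsSymmetric :=
  (isSymmetric_markovOp hrev).sub (isSymmetric_markovOp (isReversible_const π))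

theorem norm_markovOp_le_one (hK : K.Invariant π) (p : ℝ≥0∞) [hp : Fact (1 ≤ p)] :
    ‖markovOp K hK p‖ ≤ 1 :=
  LinearMap.mkContinuous_norm_le _ zero_le_one _

/-- `P - S = P (1 - S)` is a contraction, as `1 - S` is an orthogonal projection. -/
theorem norm_markovOp_sub_meanOp_le_one (hrev : K.IsReversible π) :
    ‖markovOp K hrev.invariant 2 - meanOp π 2‖ ≤ 1 := by
  refine ContinuousLinearMap.opNorm_le_bound _ zero_le_one fun f => ?_
  have h1 : (markovOp K hrev.invariant 2 - meanOp π 2) f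
      = markovOp K hrev.invariant 2 (f - meanOp π 2 f) := by
    rw [map_sub, ← mul_apply_eq_comp, markovOp_mul_meanOp]
    rfl
  have h2 : ‖f - meanOp π 2 f‖ ≤ ‖f‖ := by
    have h3 : inner ℝ f (meanOp π 2 f) = ‖meanOp π 2 f‖ ^ 2 := by
      rw [← real_inner_self_eq_norm_sq]
      conv_lhs => rw [← meanOp_mul_meanOp, mul_apply_eq_comp]
      exact (isSymmetric_markovOp (isReversible_const π) f (meanOp π 2 f)).symm
    refine abs_le_of_sq_le_sq' ?_ (norm_nonneg _) |>.2
    rw [norm_sub_sq_real, h3]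
    nlinarith [sq_nonneg ‖meanOp π 2 f‖]
  rw [h1]
  exact ((markovOp K hrev.invariant 2).le_of_opNorm_le
    (norm_markovOp_le_one hrev.invariant 2) _).trans (by simpa using h2)

end MarkovOperators

/-! ### From `L₁`-exponential convergence to an `L₂` bound -/

section L1Convergence

variable {G : Type*} [MeasurableSpace G] {π : Measure G}

/-- Hölder's inequality for the pairing of `L_p` and `L_q`, including `p, q ∈ {1, ∞}`. -/
theorem abs_integral_mul_le {p q : ℝ≥0∞} [p.HolderConjugate q] {u v : G → ℝ}
    (hu : MemLp u p π) (hv : MemLp v q π) :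
    |∫ x, u x * v x ∂π| ≤ (eLpNorm u p π).toReal * (eLpNorm v q π).toReal := by
  rw [← ENNReal.toReal_mul, ← Real.norm_eq_abs]
  have h1 : ‖∫ x, u x * v x ∂π‖ₑ ≤ eLpNorm u p π * eLpNorm v q π := by
    refine (enorm_integral_le_lintegral_enorm _).trans ?_
    rw [← eLpNorm_one_eq_lintegral_enorm]
    have h : eLpNorm (u • v) 1 π ≤ eLpNorm u p π * eLpNorm v q π :=
      eLpNorm_smul_le_mul_eLpNorm hv.1 hu.1
    exact h
  rw [← toReal_enorm]
  exact ENNReal.toReal_mono (ENNReal.mul_ne_top hu.2.ne hv.2.ne) h1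

variable [IsProbabilityMeasure π] {K : Kernel G G} [IsMarkovKernel K]

theorem markovOp_sub_meanOp_pow_ae (hK : K.Invariant π) (p : ℝ≥0∞) [hp : Fact (1 ≤ p)] {n : ℕ}
    (hn : 1 ≤ n) {F : Lp ℝ p π} {f : G → ℝ} (hF : F =ᵐ[π] f) :
    ((markovOp K hK p - meanOp π p) ^ n) F =ᵐ[π]
      fun x => ∫ y, f y ∂((K ^ n) x) - ∫ y, f y ∂π := by
  rw [markovOp_sub_meanOp_pow hK p hn, ← markovOp_pow, sub_apply]
  filter_upwards [Lp.coeFn_sub (markovOp (K ^ n) (invariant_pow hK n) p F) (meanOp π p F),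
    markovOp_ae (K ^ n) (invariant_pow hK n) p F, meanOp_ae π p F,
    average_congr (invariant_pow hK n) hF] with x a b c d
  rw [a, Pi.sub_apply, b, c, d, integral_congr_ae hF]

/-- The decay of the `n`-step averages on `L_p`, in terms of the one-step operators. -/
theorem eLpNorm_pow_average_sub_mean_le (hK : K.Invariant π) {p : ℝ≥0∞} [hp : Fact (1 ≤ p)]
    {c : ℝ} {n : ℕ} (hc : ‖markovOp K hK p ^ n - meanOp π p‖ ≤ c)
    {f : G → ℝ} (hf : MemLp f p π) :
    eLpNorm (fun x => ∫ y, f y ∂((K ^ n) x) - ∫ y, f y ∂π) p π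
      ≤ ENNReal.ofReal c * eLpNorm f p π := by
  refine (eLpNorm_average_sub_mean_le (invariant_pow hK n) hf).trans ?_
  rw [markovOp_pow hK]
  gcongr

theorem memLp_average_sub_mean (hK : K.Invariant π) {p : ℝ≥0∞} (hp : 1 ≤ p)
    {f : G → ℝ} (hf : MemLp f p π) :
    MemLp (fun x => ∫ y, f y ∂(K x) - ∫ y, f y ∂π) p π :=
  (memLp_average hK hp hf).sub (memLp_const _)

/-- For a bounded `f` the correlations `⟪(P - S)ⁿ f, f⟫` are at most `‖f‖_∞ ‖(Pⁿ - S) f‖₁`, hence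
decay at the `L₁` rate; as `P` is symmetric on `L₂`, this controls `‖P - S‖` there. -/
theorem norm_markovOp_sub_meanOp_le_of_isL1ExpConvergent (hrev : K.IsReversible π) {γ M : ℝ}
    (h : IsL1ExpConvergent K hrev.invariant γ M) :
    ‖markovOp K hrev.invariant 2 - meanOp π 2‖ ≤ γ := by
  obtain ⟨hγ, -, hM, hconv⟩ := h
  refine opNorm_le_of_inner_pow_le (isSymmetric_markovOp_sub_meanOp hrev) hγ
    (Lp.simpleFunc.dense (E := ℝ) (μ := π) (p := 2) (by simp)) fun F hF => ?_
  set s : SimpleFunc G ℝ := Lp.simpleFunc.toSimpleFunc ⟨F, hF⟩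
  have hs : F =ᵐ[π] s := (Lp.simpleFunc.toSimpleFunc_eq_toFun ⟨F, hF⟩).symm
  have hs1 : MemLp s 1 π := s.memLp_of_isFiniteMeasure 1 π
  have hsT : MemLp s ∞ π := s.memLp_of_isFiniteMeasure ∞ π
  refine ⟨M * (eLpNorm s 1 π).toReal * (eLpNorm s ∞ π).toReal, fun n hn => ?_⟩
  have h1 : inner ℝ (((markovOp K hrev.invariant 2 - meanOp π 2) ^ n) F) F
      = ∫ x, (∫ y, s y ∂((K ^ n) x) - ∫ y, s y ∂π) * s x ∂π := by
    rw [L2.inner_def]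
    refine integral_congr_ae ?_
    filter_upwards [markovOp_sub_meanOp_pow_ae hrev.invariant 2 hn hs, hs] with x hx hx'
    rw [hx, hx']
    simp [mul_comm]
  have h2 := eLpNorm_pow_average_sub_mean_le hrev.invariant (hconv n hn) hs1
  have h3 := ENNReal.toReal_mono (ENNReal.mul_ne_top ENNReal.ofReal_ne_top hs1.2.ne) h2
  rw [ENNReal.toReal_mul, ENNReal.toReal_ofReal (by positivity)] at h3
  have h4 := abs_integral_mul_le
    (memLp_average_sub_mean (invariant_pow hrev.invariant n) le_rfl hs1) hsT
  rw [h1]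
  calc _ ≤ _ := le_abs_self _
    _ ≤ _ := h4
    _ ≤ γ ^ n * M * (eLpNorm s 1 π).toReal * (eLpNorm s ∞ π).toReal := by gcongr
    _ = _ := by ring

end L1Convergence

/-! ### Interpolation between `L₂` and `L_∞` -/

section Interpolation

variable {G : Type*} [MeasurableSpace G] {π : Measure G}

theorem eLpNorm_four_pow (f : G → ℝ) :
    eLpNorm f 4 π ^ 4 = ∫⁻ x, ENNReal.ofReal (f x ^ 4) ∂π := by
  rw [eLpNorm_eq_lintegral_rpow_enorm_toReal (by norm_num) (by norm_num), ← ENNReal.rpow_natCast,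
    ← ENNReal.rpow_mul]
  have : (1 / (4 : ℝ≥0∞).toReal * (4 : ℕ) : ℝ) = 1 := by norm_num
  rw [this, ENNReal.rpow_one]
  refine lintegral_congr fun x => ?_
  have h4 : (4 : ℝ≥0∞).toReal = (4 : ℕ) := by norm_num
  rw [h4, ENNReal.rpow_natCast, ← ofReal_norm, ← ENNReal.ofReal_pow (norm_nonneg _),
    Real.norm_eq_abs, Even.pow_abs (by decide)]

theorem eLpNorm_two_pow (f : G → ℝ) :
    eLpNorm f 2 π ^ 2 = ∫⁻ x, ENNReal.ofReal (f x ^ 2) ∂π := by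
  rw [eLpNorm_eq_lintegral_rpow_enorm_toReal (by norm_num) (by norm_num), ← ENNReal.rpow_natCast,
    ← ENNReal.rpow_mul]
  have : (1 / (2 : ℝ≥0∞).toReal * (2 : ℕ) : ℝ) = 1 := by norm_num
  rw [this, ENNReal.rpow_one]
  refine lintegral_congr fun x => ?_
  have h4 : (2 : ℝ≥0∞).toReal = (2 : ℕ) := by norm_num
  rw [h4, ENNReal.rpow_natCast, ← ofReal_norm, ← ENNReal.ofReal_pow (norm_nonneg _),
    Real.norm_eq_abs, sq_abs]

variable [IsProbabilityMeasure π] {K : Kernel G G} [IsMarkovKernel K]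

/-- The weak-type estimate behind the interpolation: cutting `f` at height `t / 4`, the small part
contributes at most `t / 2` to `(P - S) f`, and the large part is controlled in `L₂`. -/
theorem sq_mul_meas_lt_abs_average_sub_mean_le (hK : K.Invariant π) {N : ℝ}
    (hN : ‖markovOp K hK 2 - meanOp π 2‖ ≤ N) {f : G → ℝ} (hfm : Measurable f)
    (hf : MemLp f 2 π) {t : ℝ} (ht : 0 < t) :
    ENNReal.ofReal (t ^ 2 / 4) * π {x | t < |∫ y, f y ∂(K x) - ∫ y, f y ∂π|}
      ≤ ENNReal.ofReal (N ^ 2) *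
        π.withDensity (fun x => ENNReal.ofReal (f x ^ 2)) {x | t < 4 * |f x|} := by
  have hN0 : 0 ≤ N := (norm_nonneg _).trans hN
  set s : Set G := {x | t < 4 * |f x|} with hs
  have hsm : MeasurableSet s := measurableSet_lt measurable_const (by fun_prop)
  set b : G → ℝ := s.indicator f with hb
  have hbL : MemLp b 2 π := hf.indicator hsm
  have hsmall : ∀ x, |f x - b x| ≤ t / 4 := by
    intro x
    by_cases hx : x ∈ s
    · simp only [hb, Set.indicator_of_mem hx, sub_self, abs_zero]
      positivity
    · have : ¬ t < 4 * |f x| := hx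
      simp only [hb, Set.indicator_of_notMem hx, sub_zero]
      linarith
  have hint : ∀ {m : Measure G} [IsProbabilityMeasure m], Integrable f m → Integrable b m →
      |∫ y, f y ∂m - ∫ y, b y ∂m| ≤ t / 4 := by
    intro m _ h1 h2
    rw [← integral_sub h1 h2]
    have h := norm_integral_le_of_norm_le_const (μ := m) (f := fun y => f y - b y)
      (.of_forall hsmall)
    simpa using h
  have hincl : π {x | t < |∫ y, f y ∂(K x) - ∫ y, f y ∂π|}
      ≤ π {x | ENNReal.ofReal (t ^ 2 / 4)
        ≤ ENNReal.ofReal ((∫ y, b y ∂(K x) - ∫ y, b y ∂π) ^ 2)} := by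
    refine measure_mono_ae ?_
    filter_upwards [ae_integrable hK one_le_two hf, ae_integrable hK one_le_two hbL] with x h1 h2
    intro (hx : t < |∫ y, f y ∂(K x) - ∫ y, f y ∂π|)
    change ENNReal.ofReal (t ^ 2 / 4) ≤ ENNReal.ofReal ((∫ y, b y ∂(K x) - ∫ y, b y ∂π) ^ 2)
    refine ENNReal.ofReal_le_ofReal ?_
    have h3 := hint h1 h2
    have h4 := hint (hf.integrable one_le_two) (hbL.integrable one_le_two)
    have h5 : t / 2 ≤ |∫ y, b y ∂(K x) - ∫ y, b y ∂π| := by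
      rw [abs_le] at h3 h4
      rcases lt_abs.mp hx with h | h
      · exact le_abs.mpr (Or.inl (by linarith))
      · exact le_abs.mpr (Or.inr (by linarith))
    rw [← sq_abs (∫ y, b y ∂(K x) - ∫ y, b y ∂π)]
    nlinarith
  calc _ ≤ ENNReal.ofReal (t ^ 2 / 4) * π {x | ENNReal.ofReal (t ^ 2 / 4)
        ≤ ENNReal.ofReal ((∫ y, b y ∂(K x) - ∫ y, b y ∂π) ^ 2)} := by gcongr
    _ ≤ ∫⁻ x, ENNReal.ofReal ((∫ y, b y ∂(K x) - ∫ y, b y ∂π) ^ 2) ∂π := by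
      refine mul_meas_ge_le_lintegral₀ ?_ _
      exact ((memLp_average_sub_mean hK one_le_two hbL).1.aemeasurable.pow_const 2).ennreal_ofReal
    _ = eLpNorm (fun x => ∫ y, b y ∂(K x) - ∫ y, b y ∂π) 2 π ^ 2 := (eLpNorm_two_pow _).symm
    _ ≤ (ENNReal.ofReal N * eLpNorm b 2 π) ^ 2 := by
      gcongr
      refine (eLpNorm_average_sub_mean_le hK hbL).trans ?_
      gcongr
    _ = ENNReal.ofReal (N ^ 2) * ∫⁻ x in s, ENNReal.ofReal (f x ^ 2) ∂π := by
      rw [mul_pow, eLpNorm_two_pow, ENNReal.ofReal_pow hN0, ← lintegral_indicator hsm]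
      congr 1
      refine lintegral_congr fun x => ?_
      by_cases hx : x ∈ s <;> simp [hb, hx]
    _ = _ := by rw [withDensity_apply _ hsm]

/-- Marcinkiewicz interpolation between the `L₂` bound `N` and the trivial `L_∞` bound `2` for
`P - S`, with the constant `4 √N` for the `L₄` norm. -/
theorem eLpNorm_four_average_sub_mean_le (hK : K.Invariant π) {N : ℝ}
    (hN : ‖markovOp K hK 2 - meanOp π 2‖ ≤ N) {f : G → ℝ} (hfm : Measurable f)
    (hf : MemLp f 4 π) :
    eLpNorm (fun x => ∫ y, f y ∂(K x) - ∫ y, f y ∂π) 4 π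
      ≤ ENNReal.ofReal (4 * √N) * eLpNorm f 4 π := by
  have hN0 : 0 ≤ N := (norm_nonneg _).trans hN
  have hf2 : MemLp f 2 π := hf.mono_exponent (by norm_num)
  set u : G → ℝ := fun x => ∫ y, f y ∂(K x) - ∫ y, f y ∂π with hu
  set ρ := π.withDensity (fun x => ENNReal.ofReal (f x ^ 2)) with hρ
  have hum : AEMeasurable (fun x => |u x|) π :=
    continuous_abs.measurable.comp_aemeasurable
      (memLp_average_sub_mean hK one_le_two hf2).1.aemeasurable
  have hcake : ∫⁻ x, ENNReal.ofReal (u x ^ 4) ∂π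
      = ENNReal.ofReal 4 * ∫⁻ t in Set.Ioi (0 : ℝ), π {x | t < |u x|} * ENNReal.ofReal (t ^ 3) := by
    have h := lintegral_rpow_eq_lintegral_meas_lt_mul π (f := fun x => |u x|)
      (.of_forall fun x => abs_nonneg _) hum (p := 4) (by norm_num)
    have e1 : ((4 : ℝ) - 1) = (3 : ℕ) := by norm_num
    have e2 : (4 : ℝ) = (4 : ℕ) := by norm_num
    rw [e1] at h
    simp only [Real.rpow_natCast] at h
    rw [← h]
    refine lintegral_congr fun x => ?_
    rw [e2, Real.rpow_natCast, Even.pow_abs (by decide)]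
  have hcake2 : ∫⁻ x, ENNReal.ofReal ((4 * |f x|) ^ 2) ∂ρ
      = ENNReal.ofReal 2 * ∫⁻ t in Set.Ioi (0 : ℝ), ρ {x | t < 4 * |f x|} * ENNReal.ofReal t := by
    have h := lintegral_rpow_eq_lintegral_meas_lt_mul ρ (f := fun x => 4 * |f x|)
      (.of_forall fun x => by positivity) (by fun_prop) (p := 2) (by norm_num)
    have e1 : ((2 : ℝ) - 1) = 1 := by norm_num
    rw [e1] at h
    simpa using h
  -- `ρ` has density `f ^ 2`, so second moments under `ρ` are fourth moments under `π`
  have hρf : ∫⁻ x, ENNReal.ofReal ((4 * |f x|) ^ 2) ∂ρ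
      = ENNReal.ofReal 16 * ∫⁻ x, ENNReal.ofReal (f x ^ 4) ∂π := by
    rw [hρ, lintegral_withDensity_eq_lintegral_mul _ (by fun_prop) (by fun_prop),
      ← lintegral_const_mul _ (by fun_prop)]
    refine lintegral_congr fun x => ?_
    rw [Pi.mul_apply, ← ENNReal.ofReal_mul (by positivity), ← ENNReal.ofReal_mul (by positivity),
      mul_pow, sq_abs]
    ring_nf
  -- the weak-type bound turns one layer cake integral into the other, which avoids interchanging
  -- the `t`-integral with the kernel
  have hmain : eLpNorm u 4 π ^ 4 ≤ (ENNReal.ofReal (4 * √N) * eLpNorm f 4 π) ^ 4 := by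
    calc eLpNorm u 4 π ^ 4
        = ENNReal.ofReal 4 *
          ∫⁻ t in Set.Ioi (0 : ℝ), π {x | t < |u x|} * ENNReal.ofReal (t ^ 3) := by
          rw [eLpNorm_four_pow, hcake]
      _ ≤ ENNReal.ofReal 4 * ∫⁻ t in Set.Ioi (0 : ℝ), ENNReal.ofReal (4 * N ^ 2) *
            (ρ {x | t < 4 * |f x|} * ENNReal.ofReal t) := by
          refine mul_le_mul' le_rfl (setLIntegral_mono' measurableSet_Ioi fun t (ht : 0 < t) => ?_)
          have h := sq_mul_meas_lt_abs_average_sub_mean_le hK hN hfm hf2 ht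
          have e1 : ENNReal.ofReal (t ^ 3)
              = ENNReal.ofReal (4 * t) * ENNReal.ofReal (t ^ 2 / 4) := by
            rw [← ENNReal.ofReal_mul (by positivity)]; ring_nf
          have e2 : ENNReal.ofReal (4 * N ^ 2) * ENNReal.ofReal t
              = ENNReal.ofReal (4 * t) * ENNReal.ofReal (N ^ 2) := by
            rw [← ENNReal.ofReal_mul (by positivity), ← ENNReal.ofReal_mul (by positivity)]
            ring_nf
          calc π {x | t < |u x|} * ENNReal.ofReal (t ^ 3)
              = ENNReal.ofReal (4 * t) * (ENNReal.ofReal (t ^ 2 / 4) * π {x | t < |u x|}) := by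
                rw [e1]; ring
            _ ≤ ENNReal.ofReal (4 * t) * (ENNReal.ofReal (N ^ 2) * ρ {x | t < 4 * |f x|}) := by
                gcongr
            _ = _ := by rw [← mul_assoc, ← e2]; ring
      _ = ENNReal.ofReal (8 * N ^ 2) * ∫⁻ x, ENNReal.ofReal ((4 * |f x|) ^ 2) ∂ρ := by
          rw [lintegral_const_mul' _ _ ENNReal.ofReal_ne_top, hcake2, ← mul_assoc, ← mul_assoc,
            ← ENNReal.ofReal_mul (by positivity), ← ENNReal.ofReal_mul (by positivity)]
          ring_nf
      _ = ENNReal.ofReal (128 * N ^ 2) * eLpNorm f 4 π ^ 4 := by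
          rw [hρf, ← mul_assoc, ← ENNReal.ofReal_mul (by positivity), eLpNorm_four_pow]
          ring_nf
      _ ≤ (ENNReal.ofReal (4 * √N) * eLpNorm f 4 π) ^ 4 := by
          rw [mul_pow, ← ENNReal.ofReal_pow (by positivity)]
          gcongr
          have : √N ^ 4 = N ^ 2 := by
            rw [show √N ^ 4 = (√N ^ 2) ^ 2 by ring, Real.sq_sqrt hN0]
          rw [mul_pow, this]
          nlinarith [sq_nonneg N]
  exact (ENNReal.pow_le_pow_left_iff (by norm_num)).mp hmain

end Interpolation

/-! ### Two-time marginals of the chain -/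

section ChainLaws

variable {G Ω : Type*} [MeasurableSpace G] [MeasurableSpace Ω] {μ : Measure Ω}
  [IsProbabilityMeasure μ] {K : Kernel G G} [IsMarkovKernel K] {ν : Measure G}
  {X : ℕ → Ω → G}

/-- The defining property of a conditional probability, for a version `u` with values in
`[0, 1]`. -/
theorem measure_inter_eq_setLIntegral_of_condExp {Ω : Type*} {m mΩ : MeasurableSpace Ω}
    {μ : Measure Ω} [IsProbabilityMeasure μ] (hle : m ≤ mΩ) {F A : Set Ω}
    (hF : MeasurableSet[m] F) (hA : MeasurableSet A) {u : Ω → ℝ≥0∞} (hu : Measurable u)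
    (hu1 : ∀ ω, u ω ≤ 1)
    (h : μ[A.indicator (fun _ => (1 : ℝ)) | m] =ᵐ[μ] fun ω => (u ω).toReal) :
    μ (F ∩ A) = ∫⁻ ω in F, u ω ∂μ := by
  have h1 := setIntegral_condExp hle
    ((integrable_const (1 : ℝ)).indicator hA : Integrable _ μ) hF
  rw [setIntegral_congr_ae (hle _ hF) (h.mono fun ω h _ => h),
    setIntegral_indicator hA, setIntegral_const, smul_eq_mul, mul_one, measureReal_def,
    integral_toReal hu.aemeasurable (.of_forall fun ω => (hu1 ω).trans_lt ENNReal.one_lt_top)] at h1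
  have hfin : ∫⁻ ω in F, u ω ∂μ ≠ ∞ :=
    ne_top_of_le_ne_top (b := ∫⁻ ω in F, 1 ∂μ) (by simp) (lintegral_mono hu1)
  exact ((ENNReal.toReal_eq_toReal_iff' hfin (measure_ne_top _ _)).mp h1).symm

theorem IsMarkovChain.measure_inter_preimage_succ (hX : IsMarkovChain K ν X μ) {i k : ℕ}
    (hi : 1 ≤ i) (hik : i ≤ k) {s t : Set G} (hs : MeasurableSet s) (ht : MeasurableSet t) :
    μ (X i ⁻¹' s ∩ X (k + 1) ⁻¹' t) = ∫⁻ ω in X i ⁻¹' s, K (X k ω) t ∂μ := by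
  have hk : 1 ≤ k := hi.trans hik
  refine measure_inter_eq_setLIntegral_of_condExp
    (iSup₂_le fun j hj => (hX.measurable j hj.1).comap_le) ?_ (hX.measurable (k + 1) (by omega) ht)
    ((K.measurable_coe ht).comp (hX.measurable k hk)) (fun ω => prob_le_one)
    (hX.transition k hk t ht)
  exact le_iSup₂_of_le (f := fun j (_ : j ∈ Set.Icc 1 k) =>
    MeasurableSpace.comap (X j) inferInstance) i ⟨hi, hik⟩ le_rfl _ ⟨s, hs, rfl⟩

/-- The states at times `i` and `i + l` have joint law `law (X i) ⊗ K ^ l`. -/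
theorem IsMarkovChain.map_pair (hX : IsMarkovChain K ν X μ) {i : ℕ} (hi : 1 ≤ i) (l : ℕ) :
    μ.map (fun ω => (X i ω, X (i + l) ω)) = (μ.map (X i)) ⊗ₘ (K ^ l) := by
  have hXi := hX.measurable i hi
  have hprob : IsProbabilityMeasure (μ.map (X i)) :=
    Measure.isProbabilityMeasure_map hXi.aemeasurable
  have hpair : ∀ l, Measurable fun ω => (X i ω, X (i + l) ω) := fun l =>
    hXi.prodMk (hX.measurable (i + l) (by omega))
  induction l with
  | zero =>
    change _ = (μ.map (X i)) ⊗ₘ Kernel.id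
    rw [Measure.compProd_id, Measure.map_map (by fun_prop) hXi]
    rfl
  | succ l ih =>
    have : IsFiniteMeasure (μ.map fun ω => (X i ω, X (i + (l + 1)) ω)) := inferInstance
    refine Measure.ext_prod fun {s t} hs ht => ?_
    have hKt : Measurable fun z : G × G => K z.2 t := (K.measurable_coe ht).comp measurable_snd
    rw [Measure.map_apply (hpair _) (hs.prod ht), Measure.compProd_apply_prod hs ht]
    calc μ ((fun ω => (X i ω, X (i + (l + 1)) ω)) ⁻¹' s ×ˢ t)
        = μ (X i ⁻¹' s ∩ X (i + l + 1) ⁻¹' t) := rfl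
      _ = ∫⁻ ω in X i ⁻¹' s, K (X (i + l) ω) t ∂μ :=
          hX.measure_inter_preimage_succ hi (by omega) hs ht
      _ = ∫⁻ z in s ×ˢ Set.univ, K z.2 t ∂(μ.map fun ω => (X i ω, X (i + l) ω)) := by
          rw [setLIntegral_map (hs.prod .univ) hKt (hpair l)]
          congr 2
          ext ω
          simp
      _ = ∫⁻ x in s, ∫⁻ y, K y t ∂((K ^ l) x) ∂(μ.map (X i)) := by
          rw [ih, Measure.setLIntegral_compProd hKt hs .univ]
          simp
      _ = ∫⁻ x in s, (K ^ (l + 1)) x t ∂(μ.map (X i)) := by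
          simp_rw [Kernel.pow_succ_apply_eq_lintegral K l _ ht]

theorem IsMarkovChain.map_eq (hX : IsMarkovChain K ν X μ) (m : ℕ) :
    μ.map (X (m + 1)) = (K ^ m) ∘ₘ ν := by
  have h1 := hX.measurable 1 le_rfl
  have hprob : IsProbabilityMeasure (μ.map (X 1)) :=
    Measure.isProbabilityMeasure_map h1.aemeasurable
  have h := congrArg Measure.snd (hX.map_pair le_rfl m)
  rw [Measure.snd_compProd, Measure.snd_map_prodMk h1, hX.initial, add_comm] at h
  exact h

/-- Correlations of the chain are integrals of `g Pˡ g` against a one-dimensional marginal. -/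
theorem IsMarkovChain.integral_mul (hX : IsMarkovChain K ν X μ) {g : G → ℝ}
    (hg : Measurable g) (m l : ℕ)
    (hint : ∀ k, 1 ≤ k → MemLp (fun ω => g (X k ω)) 2 μ) :
    ∫ ω, g (X (m + 1) ω) * g (X (m + 1 + l) ω) ∂μ
      = ∫ x, g x * ∫ y, g y ∂((K ^ l) x) ∂((K ^ m) ∘ₘ ν) := by
  have h1 := hX.measurable (m + 1) (by omega)
  have h2 := hX.measurable (m + 1 + l) (by omega)
  have hprob : IsProbabilityMeasure (μ.map (X (m + 1))) :=
    Measure.isProbabilityMeasure_map h1.aemeasurable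
  have hgg : Measurable fun z : G × G => g z.1 * g z.2 := by fun_prop
  have hI : Integrable (fun ω => g (X (m + 1) ω) * g (X (m + 1 + l) ω)) μ :=
    (hint (m + 1) (by omega)).integrable_mul (hint (m + 1 + l) (by omega))
  have hI2 : Integrable (fun z : G × G => g z.1 * g z.2)
      (μ.map fun ω => (X (m + 1) ω, X (m + 1 + l) ω)) :=
    (integrable_map_measure hgg.aestronglyMeasurable (h1.prodMk h2).aemeasurable).mpr hI
  have h3 := integral_map (μ := μ) (h1.prodMk h2).aemeasurable
    (f := fun z : G × G => g z.1 * g z.2) hgg.aestronglyMeasurable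
  rw [← h3]
  rw [hX.map_pair (by omega)] at hI2 ⊢
  rw [Measure.integral_compProd hI2, ← hX.map_eq]
  simp only [integral_const_mul]

end ChainLaws

/-! ### Convergence of the marginals to the stationary distribution -/

section Burnin

variable {G : Type*} [MeasurableSpace G] {π ν : Measure G} [IsProbabilityMeasure π]
  [IsProbabilityMeasure ν] {K : Kernel G G} [IsMarkovKernel K] {p q : ℝ≥0∞}
  [p.HolderConjugate q] [hq : Fact (1 ≤ q)]

theorem integrable_comp_of_memLp_density (hK : K.Invariant π) (hνπ : ν ≪ π)
    (hρ : MemLp (density ν π) p π) {h : G → ℝ} (hm : Measurable h) (hh : MemLp h q π) :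
    Integrable h (K ∘ₘ ν) := by
  rw [Measure.comp_eq_comp_const_apply, integrable_comp_iff hm.aestronglyMeasurable,
    Kernel.const_apply]
  refine ⟨hνπ.ae_le (ae_integrable hK hq.out hh), ?_⟩
  rw [← integrable_rnDeriv_smul_iff hνπ]
  exact hρ.integrable_mul (memLp_average hK hq.out hh.norm)

theorem integral_comp_sub_integral (hK : K.Invariant π) (hνπ : ν ≪ π)
    (hρ : MemLp (density ν π) p π) {h : G → ℝ} (hm : Measurable h) (hh : MemLp h q π) (a : ℝ) :
    ∫ x, h x ∂(K ∘ₘ ν) - ∫ x, h x ∂π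
      = ∫ x, (density ν π x - 1) * (∫ y, h y ∂(K x) - a) ∂π := by
  have hPh := memLp_average hK hq.out hh
  have hPi : Integrable (fun x => ∫ y, h y ∂(K x)) π := hPh.integrable hq.out
  have hρi : Integrable (density ν π) π := Measure.integrable_toReal_rnDeriv
  have hρ1 : ∫ x, density ν π x ∂π = 1 := by
    simp only [density]
    rw [Measure.integral_toReal_rnDeriv hνπ]
    simp
  have h1 : ∫ x, h x ∂(K ∘ₘ ν) = ∫ x, density ν π x * ∫ y, h y ∂(K x) ∂π := by
    rw [integral_comp_measure (integrable_comp_of_memLp_density hK hνπ hρ hm hh)]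
    exact (integral_rnDeriv_smul hνπ).symm
  have h2 : ∫ x, h x ∂π = ∫ x, ∫ y, h y ∂(K x) ∂π := by
    have hb : K ∘ₘ π = π := hK
    rw [← integral_comp_measure (by rw [hb]; exact hh.integrable hq.out), hb]
  have hprod : Integrable (fun x => density ν π x * ∫ y, h y ∂(K x)) π := hρ.integrable_mul hPh
  have hρs : Integrable (fun x => density ν π x - 1) π := hρi.sub (integrable_const _)
  have hps : Integrable (fun x => density ν π x * ∫ y, h y ∂(K x) - ∫ y, h y ∂(K x)) π :=
    hprod.sub hPi
  have e : ∀ x, (density ν π x - 1) * (∫ y, h y ∂(K x) - a)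
      = (density ν π x * ∫ y, h y ∂(K x) - ∫ y, h y ∂(K x)) - a * (density ν π x - 1) :=
    fun x => by ring
  simp only [e]
  rw [integral_sub hps (hρs.const_mul a),
    integral_sub hprod hPi, integral_const_mul, integral_sub hρi (integrable_const _), hρ1, h1, h2]
  simp

/-- The distance of the law of `X (m + 1)` from stationarity, tested on `h ∈ L_q`. For `m = 0`
there is no operator to use and the constant `B` has to be at least `1`. -/
theorem integral_pow_comp_le (hK : K.Invariant π) (hνπ : ν ≪ π)
    (hρ : MemLp (density ν π) p π) {γ B : ℝ} (hγ : 0 ≤ γ) (hB0 : 0 ≤ B)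
    (hB : ∀ m : ℕ, 1 ≤ m → ‖markovOp K hK q ^ m - meanOp π q‖ ≤ γ ^ m * B)
    {m : ℕ} (hm1 : 1 ≤ m ∨ 1 ≤ B) {h : G → ℝ} (hm : Measurable h) (hh : MemLp h q π) :
    ∫ x, h x ∂((K ^ m) ∘ₘ ν) ≤ ∫ x, h x ∂π +
      (eLpNorm (fun x => density ν π x - 1) p π).toReal *
        (B * γ ^ m * (eLpNorm h q π).toReal) := by
  have hρ1 : MemLp (fun x => density ν π x - 1) p π := hρ.sub (memLp_const _)
  suffices hs : ∃ u : G → ℝ, MemLp u q π ∧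
      (eLpNorm u q π).toReal ≤ B * γ ^ m * (eLpNorm h q π).toReal ∧
      ∫ x, h x ∂((K ^ m) ∘ₘ ν) - ∫ x, h x ∂π = ∫ x, (density ν π x - 1) * u x ∂π by
    obtain ⟨u, hu, hle, heq⟩ := hs
    have h1 := (le_abs_self _).trans (abs_integral_mul_le hρ1 hu)
    have h2 := mul_le_mul_of_nonneg_left hle
      (ENNReal.toReal_nonneg (a := eLpNorm (fun x => density ν π x - 1) p π))
    linarith
  rcases Nat.eq_zero_or_pos m with rfl | hmpos
  · refine ⟨h, hh, ?_, ?_⟩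
    · have hB1 : 1 ≤ B := hm1.resolve_left (by norm_num)
      rw [pow_zero, mul_one]
      exact le_mul_of_one_le_left ENNReal.toReal_nonneg hB1
    · rw [integral_comp_sub_integral (invariant_pow hK 0) hνπ hρ hm hh 0]
      refine integral_congr_ae (.of_forall fun x => ?_)
      change _ * (∫ y, h y ∂(Kernel.id x) - 0) = _
      rw [Kernel.id_apply, integral_dirac' _ _ hm.stronglyMeasurable, sub_zero]
  · refine ⟨_, memLp_average_sub_mean (invariant_pow hK m) hq.out hh, ?_,
      integral_comp_sub_integral (invariant_pow hK m) hνπ hρ hm hh _⟩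
    have h1 := eLpNorm_pow_average_sub_mean_le hK (hB m hmpos) hh
    have h2 := ENNReal.toReal_mono (ENNReal.mul_ne_top ENNReal.ofReal_ne_top hh.2.ne) h1
    rwa [ENNReal.toReal_mul, ENNReal.toReal_ofReal (by positivity), mul_comm (γ ^ m)] at h2

end Burnin

/-! ### The mean square error -/

section MeanSquare

/-- The square of a sum, grouped by the smaller index and the lag. -/
theorem sq_sum_Icc_eq (y : ℕ → ℝ) (n : ℕ) :
    (∑ j ∈ Finset.Icc 1 n, y j) ^ 2
      = ∑ j ∈ Finset.Icc 1 n, (y j * y j + 2 * ∑ l ∈ Finset.Icc 1 (n - j), y j * y (j + l)) := by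
  induction n with
  | zero => simp
  | succ n ih =>
    have h : ∀ j ∈ Finset.Icc 1 n,
        y j * y j + 2 * ∑ l ∈ Finset.Icc 1 (n + 1 - j), y j * y (j + l)
          = (y j * y j + 2 * ∑ l ∈ Finset.Icc 1 (n - j), y j * y (j + l))
            + 2 * y j * y (n + 1) := by
      intro j hj
      have hjn := (Finset.mem_Icc.mp hj).2
      rw [Nat.sub_add_comm hjn, Finset.sum_Icc_succ_top (by omega),
        show j + (n - j + 1) = n + 1 by omega]
      ring
    rw [Finset.sum_Icc_succ_top (by omega), Finset.sum_Icc_succ_top (by omega),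
      Finset.sum_congr rfl h, Finset.sum_add_distrib, ← Finset.sum_mul, ← Finset.mul_sum, add_sq,
      ih]
    simp
    ring

theorem sum_Icc_pow_pred_le {γ : ℝ} (h0 : 0 ≤ γ) (h1 : γ < 1) (n : ℕ) :
    ∑ j ∈ Finset.Icc 1 n, γ ^ (j - 1) ≤ 1 / (1 - γ) := by
  have h : ∑ j ∈ Finset.Icc 1 n, γ ^ (j - 1) = (1 - γ ^ n) / (1 - γ) := by
    have : (1 - γ) ≠ 0 := by linarith
    induction n with
    | zero => simp
    | succ n ih =>
      rw [Finset.sum_Icc_succ_top (by omega), ih, Nat.add_sub_cancel]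
      field_simp
      ring
  rw [h]
  have := pow_nonneg h0 n
  gcongr
  linarith

theorem one_add_two_mul_sum_Icc_pow_le {γ : ℝ} (h0 : 0 ≤ γ) (h1 : γ < 1) (n : ℕ) :
    1 + 2 * ∑ l ∈ Finset.Icc 1 n, γ ^ l ≤ 2 / (1 - γ) := by
  have h : ∑ l ∈ Finset.Icc 1 n, γ ^ l = γ * ∑ l ∈ Finset.Icc 1 n, γ ^ (l - 1) := by
    rw [Finset.mul_sum]
    refine Finset.sum_congr rfl fun l hl => ?_
    rw [← pow_succ', Nat.sub_add_cancel (Finset.mem_Icc.mp hl).1]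
  have h2 := mul_le_mul_of_nonneg_left (sum_Icc_pow_pred_le h0 h1 n) h0
  have h3 : (0 : ℝ) < 1 - γ := by linarith
  have h4 : γ * (1 / (1 - γ)) = 1 / (1 - γ) - 1 := by field_simp; ring
  have h5 : 2 / (1 - γ) = 2 * (1 / (1 - γ)) := by ring
  rw [h, h5]
  linarith

variable {G Ω : Type*} [MeasurableSpace G] [MeasurableSpace Ω] {μ : Measure Ω}
  [IsProbabilityMeasure μ] {K : Kernel G G} [IsMarkovKernel K] {π ν : Measure G}
  [IsProbabilityMeasure π] [IsProbabilityMeasure ν] {X : ℕ → Ω → G}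

theorem average_pow_zero (K : Kernel G G) {g : G → ℝ} (hg : Measurable g) (x : G) :
    ∫ y, g y ∂((K ^ 0) x) = g x := by
  change ∫ y, g y ∂(Kernel.id x) = g x
  rw [Kernel.id_apply, integral_dirac' _ _ hg.stronglyMeasurable]

/-- The stationary correlations of a mean zero function, as quadratic forms of `P - S`. -/
theorem integral_mul_average_pow_eq_inner (hK : K.Invariant π) {g : G → ℝ} (hg : Measurable g)
    (hg2 : MemLp g 2 π) (hg0 : ∫ x, g x ∂π = 0) (l : ℕ) :
    ∫ x, g x * ∫ y, g y ∂((K ^ l) x) ∂π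
      = inner ℝ (((markovOp K hK 2 - meanOp π 2) ^ l) hg2.toLp) hg2.toLp := by
  rw [L2.inner_def]
  have hF : hg2.toLp =ᵐ[π] g := hg2.coeFn_toLp
  refine integral_congr_ae ?_
  rcases Nat.eq_zero_or_pos l with rfl | hl
  · filter_upwards [hF] with x hx
    rw [average_pow_zero K hg]
    simp [hx, sq]
  · filter_upwards [hF, markovOp_sub_meanOp_pow_ae hK 2 hl hF] with x hx hx'
    rw [hx, hx', hg0]
    simp

theorem stationary_correlation_sum_le (hrev : K.IsReversible π)
    (hΛ : spectralTop K hrev.invariant < 1) {g : G → ℝ} (hg : Measurable g)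
    (hg2 : MemLp g 2 π) (hg0 : ∫ x, g x ∂π = 0) (hg1 : eLpNorm g 2 π ≤ 1) (N : ℕ) :
    ∫ x, g x * ∫ y, g y ∂((K ^ 0) x) ∂π
        + 2 * ∑ l ∈ Finset.Icc 1 N, ∫ x, g x * ∫ y, g y ∂((K ^ l) x) ∂π
      ≤ 2 / (1 - spectralTop K hrev.invariant) := by
  simp only [integral_mul_average_pow_eq_inner hrev.invariant hg hg2 hg0]
  have h := norm_sq_add_two_mul_sum_inner_pow_le (isSymmetric_markovOp_sub_meanOp hrev)
    (norm_markovOp_sub_meanOp_le_one hrev) hΛ hg2.toLp N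
  have hn : ‖hg2.toLp‖ ≤ 1 := by
    rw [Lp.norm_toLp]
    exact ENNReal.toReal_le_of_le_ofReal zero_le_one (by simpa using hg1)
  have hpos : 0 ≤ 2 / (1 - sSup (spectrum ℝ (markovOp K hrev.invariant 2 - meanOp π 2))) := by
    have : (0 : ℝ) < 1 - spectralTop K hrev.invariant := by linarith
    exact (div_pos two_pos this).le
  rw [pow_zero, one_apply_eq_self, real_inner_self_eq_norm_sq]
  exact h.trans (mul_le_of_le_one_right hpos (pow_le_one₀ (norm_nonneg _) hn))

/-- The error bound for a centred function `g`, given bounds `d l` for the `L_q` norms of the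
lagged products `g Pˡ g`, where `q` is conjugate to the exponent `p` of the initial density. -/
theorem lintegral_sq_average_le {p q : ℝ≥0∞} [p.HolderConjugate q] [hq : Fact (1 ≤ q)]
    (hrev : K.IsReversible π) (hX : IsMarkovChain K ν X μ)
    (hΛ : spectralTop K hrev.invariant < 1) {n n₀ : ℕ} (hn : 1 ≤ n) (hνπ : ν ≪ π)
    (hρ : MemLp (density ν π) p π) {γ B D : ℝ} (hγ : 0 ≤ γ) (hγ1 : γ < 1) (hB0 : 0 ≤ B)
    (hD0 : 0 ≤ D)
    (hB : ∀ m : ℕ, 1 ≤ m → ‖markovOp K hrev.invariant q ^ m - meanOp π q‖ ≤ γ ^ m * B)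
    (hstart : 1 ≤ n₀ ∨ 1 ≤ B) {g : G → ℝ} (hg : Measurable g) (hg2 : MemLp g 2 π)
    (hg0 : ∫ x, g x ∂π = 0) (hg1 : eLpNorm g 2 π ≤ 1) {d : ℕ → ℝ}
    (hd : ∀ l, MemLp (fun x => g x * ∫ y, g y ∂((K ^ l) x)) q π ∧
      (eLpNorm (fun x => g x * ∫ y, g y ∂((K ^ l) x)) q π).toReal ≤ d l)
    (hD : ∀ N, d 0 + 2 * ∑ l ∈ Finset.Icc 1 N, d l ≤ D) :
    ∫⁻ ω, ENNReal.ofReal ((1 / n * ∑ j ∈ Finset.Icc 1 n, g (X (j + n₀) ω)) ^ 2) ∂μ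
      ≤ ENNReal.ofReal (2 / (n * (1 - spectralTop K hrev.invariant)) +
        (eLpNorm (fun x => density ν π x - 1) p π).toReal * B * D * γ ^ n₀ /
          (n ^ 2 * (1 - γ))) := by
  set R := (eLpNorm (fun x => density ν π x - 1) p π).toReal with hR
  have hR0 : 0 ≤ R := ENNReal.toReal_nonneg
  set L := spectralTop K hrev.invariant with hL
  have hL1 : 0 < 1 - L := by linarith
  have hγ' : 0 < 1 - γ := by linarith
  have hn0 : (0 : ℝ) < n := by exact_mod_cast hn
  have hcm : ∀ l, Measurable fun x => g x * ∫ y, g y ∂((K ^ l) x) := fun l =>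
    hg.mul (hg.stronglyMeasurable.integral_kernel (κ := K ^ l)).measurable
  have hmem : ∀ k, 1 ≤ k → MemLp (fun ω => g (X k ω)) 2 μ := by
    intro k hk
    obtain ⟨m, rfl⟩ : ∃ m, k = m + 1 := ⟨k - 1, by omega⟩
    have hXm := hX.measurable _ hk
    refine (memLp_two_iff_integrable_sq (hg.comp hXm).aestronglyMeasurable).mpr ?_
    have h1 := integrable_comp_of_memLp_density (invariant_pow hrev.invariant m) hνπ hρ
      (hcm 0) (hd 0).1
    rw [← hX.map_eq, integrable_map_measure (hcm 0).aestronglyMeasurable hXm.aemeasurable] at h1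
    refine h1.congr (.of_forall fun ω => ?_)
    simp only [average_pow_zero K hg, Function.comp_apply, sq]
  -- `c l` is the correlation at lag `l` of the stationary chain
  set c : ℕ → ℝ := fun l => ∫ x, g x * ∫ y, g y ∂((K ^ l) x) ∂π with hc
  have hcorr : ∀ j ∈ Finset.Icc 1 n, ∀ l,
      ∫ ω, g (X (j + n₀) ω) * g (X (j + l + n₀) ω) ∂μ
        ≤ c l + R * B * γ ^ n₀ * γ ^ (j - 1) * d l := by
    intro j hj l
    have hj1 := (Finset.mem_Icc.mp hj).1
    have e1 : j + n₀ = n₀ + (j - 1) + 1 := by omega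
    have e2 : j + l + n₀ = n₀ + (j - 1) + 1 + l := by omega
    rw [e1, e2, hX.integral_mul hg _ _ hmem]
    refine (integral_pow_comp_le hrev.invariant hνπ hρ hγ hB0 hB
      (hstart.imp_left fun h => by omega) (hcm l) (hd l).1).trans ?_
    have h1 : R * (B * γ ^ (n₀ + (j - 1)) *
        (eLpNorm (fun x => g x * ∫ y, g y ∂((K ^ l) x)) q π).toReal)
        ≤ R * (B * γ ^ (n₀ + (j - 1)) * d l) := by
      have := (hd l).2
      gcongr
    refine (add_le_add_right h1 _).trans (le_of_eq ?_)
    rw [pow_add]; ring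
  have hrow : ∀ j ∈ Finset.Icc 1 n,
      ∫ ω, g (X (j + n₀) ω) * g (X (j + n₀) ω) ∂μ + 2 * ∑ l ∈ Finset.Icc 1 (n - j),
        ∫ ω, g (X (j + n₀) ω) * g (X (j + l + n₀) ω) ∂μ
      ≤ 2 / (1 - L) + R * B * γ ^ n₀ * D * γ ^ (j - 1) := by
    intro j hj
    have h0 := hcorr j hj 0
    have hs := Finset.sum_le_sum fun l (_ : l ∈ Finset.Icc 1 (n - j)) => hcorr j hj l
    rw [Finset.sum_add_distrib, ← Finset.mul_sum] at hs
    have hstat := stationary_correlation_sum_le hrev hΛ hg hg2 hg0 hg1 (n - j)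
    have hDj := mul_le_mul_of_nonneg_left (hD (n - j))
      (by positivity : 0 ≤ R * B * γ ^ n₀ * γ ^ (j - 1))
    simp only [add_zero] at h0
    simp only [hc] at h0 hs
    linarith
  have hpair : ∀ j ∈ Finset.Icc 1 n, ∀ k,
      Integrable (fun ω => g (X (j + n₀) ω) * g (X (j + k + n₀) ω)) μ := by
    intro j hj k
    have hj1 := (Finset.mem_Icc.mp hj).1
    exact (hmem _ (by omega)).integrable_mul (hmem _ (by omega))
  have hpair0 : ∀ j ∈ Finset.Icc 1 n,
      Integrable (fun ω => g (X (j + n₀) ω) * g (X (j + n₀) ω)) μ :=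
    fun j hj => hpair j hj 0
  have hsums : ∀ j ∈ Finset.Icc 1 n, Integrable (fun ω => 2 * ∑ l ∈ Finset.Icc 1 (n - j),
      g (X (j + n₀) ω) * g (X (j + l + n₀) ω)) μ := fun j hj =>
    (integrable_finsetSum _ fun l _ => hpair j hj l).const_mul 2
  have hsq : ∀ ω, (1 / n * ∑ j ∈ Finset.Icc 1 n, g (X (j + n₀) ω)) ^ 2
      = (1 / n : ℝ) ^ 2 * ∑ j ∈ Finset.Icc 1 n, (g (X (j + n₀) ω) * g (X (j + n₀) ω)
        + 2 * ∑ l ∈ Finset.Icc 1 (n - j), g (X (j + n₀) ω) * g (X (j + l + n₀) ω)) := fun ω => by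
    rw [mul_pow, sq_sum_Icc_eq fun j => g (X (j + n₀) ω)]
  have hterm : ∀ j ∈ Finset.Icc 1 n, Integrable (fun ω => g (X (j + n₀) ω) * g (X (j + n₀) ω)
      + 2 * ∑ l ∈ Finset.Icc 1 (n - j), g (X (j + n₀) ω) * g (X (j + l + n₀) ω)) μ :=
    fun j hj => (hpair0 j hj).add (hsums j hj)
  have hint : Integrable
      (fun ω => (1 / n * ∑ j ∈ Finset.Icc 1 n, g (X (j + n₀) ω)) ^ 2) μ := by
    simp only [hsq]
    exact (integrable_finsetSum _ hterm).const_mul _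
  rw [← ofReal_integral_eq_lintegral_ofReal hint (.of_forall fun ω => sq_nonneg _)]
  refine ENNReal.ofReal_le_ofReal ?_
  simp only [hsq]
  rw [integral_const_mul, integral_finsetSum _ hterm]
  have hexp : ∀ j ∈ Finset.Icc 1 n, ∫ ω, (g (X (j + n₀) ω) * g (X (j + n₀) ω)
        + 2 * ∑ l ∈ Finset.Icc 1 (n - j), g (X (j + n₀) ω) * g (X (j + l + n₀) ω)) ∂μ
      ≤ 2 / (1 - L) + R * B * γ ^ n₀ * D * γ ^ (j - 1) := by
    intro j hj
    rw [integral_add (hpair0 j hj) (hsums j hj), integral_const_mul,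
      integral_finsetSum _ fun l _ => hpair j hj l]
    exact hrow j hj
  calc _ ≤ (1 / n : ℝ) ^ 2 * ∑ j ∈ Finset.Icc 1 n,
        (2 / (1 - L) + R * B * γ ^ n₀ * D * γ ^ (j - 1)) := by
        gcongr with j hj
        exact hexp j hj
    _ = (1 / n : ℝ) ^ 2 * (n * (2 / (1 - L))
        + R * B * γ ^ n₀ * D * ∑ j ∈ Finset.Icc 1 n, γ ^ (j - 1)) := by
        rw [Finset.sum_add_distrib, ← Finset.mul_sum]
        simp
    _ ≤ (1 / n : ℝ) ^ 2 * (n * (2 / (1 - L)) + R * B * γ ^ n₀ * D * (1 / (1 - γ))) := by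
        have := sum_Icc_pow_pred_le hγ hγ1 n
        gcongr
    _ = _ := by field_simp

/-- Centring `f` turns the mean square error into that of a mean zero function. -/
theorem worstCaseSqError_le {G Ω : Type*} [MeasurableSpace G] [MeasurableSpace Ω]
    {μ : Measure Ω} {π : Measure G} {X : ℕ → Ω → G} {p : ℝ≥0∞} {n n₀ : ℕ} (hn : 1 ≤ n) {b : ℝ≥0∞}
    (h : ∀ f : G → ℝ, Measurable f → eLpNorm f p π ≤ 1 →
      ∫⁻ ω, ENNReal.ofReal ((1 / n * ∑ j ∈ Finset.Icc 1 n,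
        (f (X (j + n₀) ω) - ∫ x, f x ∂π)) ^ 2) ∂μ ≤ b) :
    worstCaseSqError μ π X n n₀ p ≤ b := by
  refine iSup_le fun f => iSup_le fun hf => iSup_le fun hf1 => ?_
  have hn0 : (n : ℝ) ≠ 0 := by positivity
  rw [mcmcError, ← ENNReal.rpow_natCast, ← ENNReal.rpow_mul]
  norm_num only [ENNReal.rpow_one]
  refine le_trans (lintegral_mono fun ω => ENNReal.ofReal_le_ofReal (le_of_eq ?_)) (h f hf hf1)
  rw [sq_abs, mcmcAverage, Finset.sum_sub_distrib]
  simp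
  field_simp

end MeanSquare

/-! ### Norms of the lagged products -/

section LaggedProducts

variable {G : Type*} [MeasurableSpace G] {K : Kernel G G} [IsMarkovKernel K] {π : Measure G}
  [IsProbabilityMeasure π]

theorem isReversible_id (π : Measure G) : (Kernel.id : Kernel G G).IsReversible π := by
  intro A B hA hB
  simp [Kernel.id_apply, Measure.dirac_apply', hA, hB,
    Measure.restrict_apply, Set.inter_comm]

/-- `‖Pˡ - S‖ ≤ γˡ` on `L₂`; for `l = 0` this holds as `1 - S` is an orthogonal projection. -/
theorem norm_markovOp_pow_sub_meanOp_le (hrev : K.IsReversible π) {γ : ℝ}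
    (hγ : ‖markovOp K hrev.invariant 2 - meanOp π 2‖ ≤ γ) (l : ℕ) :
    ‖markovOp (K ^ l) (invariant_pow hrev.invariant l) 2 - meanOp π 2‖ ≤ γ ^ l := by
  rcases Nat.eq_zero_or_pos l with rfl | hl
  · refine le_of_le_of_eq ?_ (pow_zero γ).symm
    exact norm_markovOp_sub_meanOp_le_one (K := K ^ 0) (isReversible_id π)
  · rw [markovOp_pow hrev.invariant, ← markovOp_sub_meanOp_pow hrev.invariant 2 hl]
    exact (norm_pow_le' _ hl).trans (by gcongr)

/-- The centred product `g Pˡ g`, `g = f - S f`, is the product of `(1 - S) f` and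
`(Pˡ - S) f`. -/
theorem centred_mul_average_ae (hK : K.Invariant π) {f : G → ℝ} (hfm : Measurable f)
    (hf : Integrable f π) (l : ℕ) :
    (fun x => (f x - ∫ z, f z ∂π) * ∫ y, (f y - ∫ z, f z ∂π) ∂((K ^ l) x)) =ᵐ[π]
      (fun x => ∫ y, f y ∂((K ^ 0) x) - ∫ y, f y ∂π) •
        fun x => ∫ y, f y ∂((K ^ l) x) - ∫ y, f y ∂π := by
  filter_upwards [ae_integrable (invariant_pow hK l) le_rfl (memLp_one_iff_integrable.mpr hf)]
    with x hx
  rw [Pi.smul_apply', smul_eq_mul, average_pow_zero K hfm, integral_sub hx (integrable_const _)]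
  simp

/-- Hölder's inequality for the lagged products, from bounds for `(Pˡ - S) f` in `L_r`. -/
theorem memLp_centred_mul_average {r q : ℝ≥0∞} [r.HolderTriple r q] (hr : 1 ≤ r)
    (hK : K.Invariant π) {f : G → ℝ} (hfm : Measurable f) (hf : MemLp f r π) {a : ℕ → ℝ}
    (ha0 : ∀ l, 0 ≤ a l)
    (ha : ∀ l, eLpNorm (fun x => ∫ y, f y ∂((K ^ l) x) - ∫ y, f y ∂π) r π
      ≤ ENNReal.ofReal (a l)) (l : ℕ) :
    MemLp (fun x => (f x - ∫ z, f z ∂π) * ∫ y, (f y - ∫ z, f z ∂π) ∂((K ^ l) x)) q π ∧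
      (eLpNorm (fun x => (f x - ∫ z, f z ∂π) * ∫ y, (f y - ∫ z, f z ∂π) ∂((K ^ l) x))
        q π).toReal ≤ a 0 * a l := by
  have hae := centred_mul_average_ae hK hfm (hf.integrable hr) l
  have hm : ∀ l, MemLp (fun x => ∫ y, f y ∂((K ^ l) x) - ∫ y, f y ∂π) r π := fun l =>
    memLp_average_sub_mean (invariant_pow hK l) hr hf
  refine ⟨(memLp_congr_ae hae).mpr ((hm l).smul (hm 0)), ?_⟩
  refine ENNReal.toReal_le_of_le_ofReal (mul_nonneg (ha0 0) (ha0 l)) ?_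
  rw [eLpNorm_congr_ae hae, ENNReal.ofReal_mul (ha0 0)]
  exact (eLpNorm_smul_le_mul_eLpNorm (hm l).1 (hm 0).1).trans (mul_le_mul' (ha 0) (ha l))

theorem centred_memLp_integral_eLpNorm (hrev : K.IsReversible π) {f : G → ℝ} (hfm : Measurable f)
    (hf : MemLp f 2 π) (hf1 : eLpNorm f 2 π ≤ 1) :
    MemLp (fun x => f x - ∫ z, f z ∂π) 2 π ∧ ∫ x, (f x - ∫ z, f z ∂π) ∂π = 0 ∧
      eLpNorm (fun x => f x - ∫ z, f z ∂π) 2 π ≤ 1 := by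
  refine ⟨hf.sub (memLp_const _), ?_, ?_⟩
  · rw [integral_sub (hf.integrable one_le_two) (integrable_const _)]
    simp
  · have h := eLpNorm_average_sub_mean_le (invariant_pow hrev.invariant 0) hf
    simp only [average_pow_zero K hfm] at h
    refine h.trans (mul_le_one' ?_ hf1)
    rw [← ENNReal.ofReal_one]
    exact ENNReal.ofReal_le_ofReal
      (norm_markovOp_pow_sub_meanOp_le hrev (norm_markovOp_sub_meanOp_le_one hrev) 0)

end LaggedProducts

end MCMC

/-! ### The error bounds -/

theorem mainTheorem5 {G Ω : Type*} [MeasurableSpace G] [MeasurableSpace Ω]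
    (μ : Measure Ω) [IsProbabilityMeasure μ]
    (K : Kernel G G) [IsMarkovKernel K]
    (π : Measure G) [IsProbabilityMeasure π] (hrev : K.IsReversible π)
    (ν : Measure G) [IsProbabilityMeasure ν]
    (X : ℕ → Ω → G) (hX : MCMC.IsMarkovChain K ν X μ)
    (hΛ : MCMC.spectralTop K hrev.invariant < 1)
    (n n₀ : ℕ) (hn : 1 ≤ n) :
    (∀ γ M : ℝ, MCMC.IsL1ExpConvergent K hrev.invariant γ M →
      ν ≪ π → MemLp (MCMC.density ν π) ∞ π →
      (1 ≤ n₀ ∨ 1 ≤ M) →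
      MCMC.worstCaseSqError μ π X n n₀ 2 ≤ ENNReal.ofReal
        (2 / (n * (1 - MCMC.spectralTop K hrev.invariant)) +
          2 * (M * (eLpNorm (fun x => MCMC.density ν π x - 1) ∞ π).toReal) * γ ^ n₀ /
            (n ^ 2 * (1 - γ) ^ 2))) ∧
    (∀ γ : ℝ, 1 - γ = MCMC.gap K hrev.invariant → 0 < MCMC.gap K hrev.invariant →
      ν ≪ π → MemLp (MCMC.density ν π) 2 π →
      MCMC.worstCaseSqError μ π X n n₀ 4 ≤ ENNReal.ofReal
        (2 / (n * (1 - MCMC.spectralTop K hrev.invariant)) +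
          2 * (64 * (eLpNorm (fun x => MCMC.density ν π x - 1) 2 π).toReal) * γ ^ n₀ /
            (n ^ 2 * (1 - γ) ^ 2))) := by
  have hn0 : (0 : ℝ) < n := by exact_mod_cast hn
  refine ⟨fun γ M hconv hνπ hρ hstart => ?_, fun γ hγ hgap hνπ hρ => ?_⟩
  · have hnorm := MCMC.norm_markovOp_sub_meanOp_le_of_isL1ExpConvergent hrev hconv
    obtain ⟨hγ0, hγ1, hM, hB⟩ := hconv
    have hγ' : 0 < 1 - γ := by linarith
    refine MCMC.worstCaseSqError_le hn fun f hfm hf1 => ?_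
    have hf : MemLp f 2 π := ⟨hfm.aestronglyMeasurable, hf1.trans_lt ENNReal.one_lt_top⟩
    obtain ⟨hg2, hg0, hg1⟩ := MCMC.centred_memLp_integral_eLpNorm hrev hfm hf hf1
    have ha : ∀ l, eLpNorm (fun x => ∫ y, f y ∂((K ^ l) x) - ∫ y, f y ∂π) 2 π
        ≤ ENNReal.ofReal (γ ^ l) := fun l =>
      (MCMC.eLpNorm_average_sub_mean_le (MCMC.invariant_pow hrev.invariant l) hf).trans <|
        (mul_le_of_le_one_right' hf1).trans <|
          ENNReal.ofReal_le_ofReal (MCMC.norm_markovOp_pow_sub_meanOp_le hrev hnorm l)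
    refine (MCMC.lintegral_sq_average_le (p := ∞) (q := 1) (d := fun l => γ ^ 0 * γ ^ l)
      (D := 2 / (1 - γ)) hrev hX hΛ hn hνπ hρ hγ0 hγ1 hM.le (by positivity) hB hstart
      (hfm.sub_const _) hg2 hg0 hg1
      (MCMC.memLp_centred_mul_average one_le_two hrev.invariant hfm hf
        (fun l => pow_nonneg hγ0 l) ha) fun N => ?_).trans ?_
    · simpa using MCMC.one_add_two_mul_sum_Icc_pow_le hγ0 hγ1 N
    · refine ENNReal.ofReal_le_ofReal (add_le_add_right (le_of_eq ?_) _)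
      field_simp
  · have hγn : ‖MCMC.markovOp K hrev.invariant 2 - MCMC.meanOp π 2‖ = γ := by
      rw [MCMC.gap] at hγ; linarith
    have hγ0 : 0 ≤ γ := hγn ▸ norm_nonneg _
    have hγ' : 0 < 1 - γ := hγ ▸ hgap
    have hγ1 : γ < 1 := by linarith
    have hs0 : 0 ≤ √γ := Real.sqrt_nonneg γ
    have hs1 : √γ < 1 := by rw [Real.sqrt_lt' one_pos]; simpa using hγ1
    have hss : √γ ^ 2 = γ := Real.sq_sqrt hγ0
    have : ENNReal.HolderTriple 4 4 2 := ⟨by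
      rw [← ENNReal.toReal_eq_toReal_iff' (by simp) (by simp)]
      rw [ENNReal.toReal_add (by simp) (by simp)]
      norm_num⟩
    refine MCMC.worstCaseSqError_le hn fun f hfm hf1 => ?_
    have hf : MemLp f 4 π := ⟨hfm.aestronglyMeasurable, hf1.trans_lt ENNReal.one_lt_top⟩
    obtain ⟨hg2, hg0, hg1⟩ := MCMC.centred_memLp_integral_eLpNorm hrev hfm
      (hf.mono_exponent (by norm_num))
      ((eLpNorm_le_eLpNorm_of_exponent_le (by norm_num) hf.1).trans hf1)
    have ha : ∀ l, eLpNorm (fun x => ∫ y, f y ∂((K ^ l) x) - ∫ y, f y ∂π) 4 π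
        ≤ ENNReal.ofReal (4 * √γ ^ l) := fun l => by
      have hsl : √(γ ^ l) = √γ ^ l := by
        conv_lhs => rw [← hss, ← pow_mul, mul_comm, pow_mul]
        exact Real.sqrt_sq (by positivity)
      rw [← hsl]
      exact (MCMC.eLpNorm_four_average_sub_mean_le (MCMC.invariant_pow hrev.invariant l)
        (MCMC.norm_markovOp_pow_sub_meanOp_le hrev hγn.le l) hfm hf).trans
          (mul_le_of_le_one_right' hf1)
    -- each factor of `g Pˡ g` costs the interpolation constant `4`; summing `√γ ^ l` costs
    -- `2 / (1 - √γ) ≤ 4 / (1 - γ)`, whence `64 = 4 * 4 * 4`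
    refine (MCMC.lintegral_sq_average_le (p := 2) (q := 2) (B := 1)
      (d := fun l => 4 * √γ ^ 0 * (4 * √γ ^ l)) (D := 64 / (1 - γ)) hrev hX hΛ hn hνπ hρ
      hγ0 hγ1 zero_le_one (by positivity) (fun m _ => ?_) (Or.inr le_rfl) (hfm.sub_const _)
      hg2 hg0 hg1 (MCMC.memLp_centred_mul_average (by norm_num) hrev.invariant hfm hf
        (fun l => by positivity) ha) fun N => ?_).trans ?_
    · rw [mul_one, ← MCMC.markovOp_pow]
      exact MCMC.norm_markovOp_pow_sub_meanOp_le hrev hγn.le m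
    · -- `1 / (1 - √γ) = (1 + √γ) / (1 - γ) ≤ 2 / (1 - γ)`
      have h1 := MCMC.one_add_two_mul_sum_Icc_pow_le hs0 hs1 N
      have h2 : 2 / (1 - √γ) ≤ 4 / (1 - γ) := by
        rw [div_le_div_iff₀ (by linarith) hγ']
        nlinarith
      have h3 : 64 / (1 - γ) = 16 * (4 / (1 - γ)) := by ring
      rw [h3]
      calc _ = 16 * (1 + 2 * ∑ l ∈ Finset.Icc 1 N, √γ ^ l) := by
            simp only [← Finset.mul_sum]
            ring
        _ ≤ _ := by linarith
    · set R := (eLpNorm (fun x => MCMC.density ν π x - 1) 2 π).toReal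
      have hR : 0 ≤ R := ENNReal.toReal_nonneg
      refine ENNReal.ofReal_le_ofReal (add_le_add_right ?_ _)
      calc R * 1 * (64 / (1 - γ)) * γ ^ n₀ / (n ^ 2 * (1 - γ))
          = 64 * R * γ ^ n₀ / (n ^ 2 * (1 - γ) ^ 2) := by field_simp
        _ ≤ _ := by
          gcongr ?_ * _ / _
          linarith
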